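/- **Setting.** Let $d\ge 0$ be an integer, let $\Lambda$ be a countable index set and let $\psi_\lambda\in L^1(\mathbb R^d;\mathbb C)$, $\lambda\in\Lambda$, be filters with Fourier transforms $\widehat\psi_\lambda(\omega)=\int\psi_\lambda(u)e^{-i\omega\cdot u}\,du$. Assume the Littlewood–Paley condition: for some $0\le\eta<1$ and almost all $\omega\in\mathbb R^d$, $$(1-\eta)^2\le\frac12\sum_{\lambda\in\Lambda}\big(|\widehat\psi_\lambda(\omega)|^2+|\widehat\psi_\lambda(-\omega)|^2\big)\le(1+\eta)^2 .$$ Let $h$ be a $2\pi$-periodic (real- or complex-valued) function with $\|h\|^2=\frac1{2\pi}\int_0^{2\pi}|h(\alpha)|^2d\alpha<\infty$ and Fourier coefficients $\widehat h(k)=\frac1{2\pi}\int_0^{2\pi}h(\alpha)e^{-ik\alpha}d\alpha$, and let $\kappa\ge 0$ be given by $$\kappa^2=|\widehat h(0)|^2+\sum_{k\in\mathbb Z}k^2|\widehat h(k)|^2 .$$ For a real-valued signal $x$, put $$Ux(u,\lambda,\alpha)=|x\star\psi_\lambda(u)|\;h\big(\alpha-\varphi(x\star\psi_\lambda(u))\big),$$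 where $\varphi(z)$ is the complex phase of $z$. Vectors $v(\lambda,\alpha)$ are normed by $\|v\|^2=\frac1{2\pi}\sum_{\lambda}\int_0^{2\pi}|v(\lambda,\alpha)|^2d\alpha$, and $\|\cdot\|_{2,2}$ is the corresponding operator norm. * For a real $x\in L^2([0,L]^d)$, $L>0$, let $Mx(\lambda,\alpha)=\int_{[0,L]^d}Ux(u,\lambda,\alpha)\,du$, where the convolutions $x\star\psi_\lambda$ are periodic convolutions over $[0,L]^d$, i.e. $x\star\psi_\lambda(u)=\int_{\mathbb R^d}x_{\rm per}(v)\psi_\lambda(u-v)\,dv$ with $x_{\rm per}$ the $L$-periodic extension of $x$ in each coordinate. * For a real $x\in L^2(\mathbb R^d)$, with convolutions over $\mathbb R^d$, let $Cx(\lambda,\alpha,\lambda',\alpha')=\int_{\mathbb R^d}Ux(u,\lambda,\alpha)\,Ux(u,\lambda',\alpha')^*\,du$, and denote also by $Cx$ the operator $$Cx\,v(\lambda,\alpha)=\frac1{2\pi}\sum_{\lambda'\in\Lambda}\int_0^{2\pi}Cx(\lambda,\alpha,\lambda',\alpha')\,v(\lambda',\alpha')\,d\alpha' .$$ **Theorem.**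 The integral defining $Mx$ converges absolutely for every $\lambda$ and almost every $\alpha$, and $\|Mx\|<\infty$; for every $\lambda$ and almost every $\alpha$, $Ux(\cdot,\lambda,\alpha)\in L^2(\mathbb R^d)$; and $Cx$ is a bounded operator of trace class. Moreover: 1. If $\kappa<\infty$, then for all $L>0$ and all real $x,x'\in L^2([0,L]^d)$, $$\|Mx-Mx'\|\le\kappa\,(1+\eta)\,L^{d/2}\,\|x-x'\| .$$ 2. For all real $x\in L^2(\mathbb R^d)$, $$(1-\eta)^2\|h\|^2\|x\|^2\le\operatorname{Trace}(Cx)\le(1+\eta)^2\|h\|^2\|x\|^2 .$$ 3. If $\kappa<\infty$, then for all real $x,x'\in L^2(\mathbb R^d)$, $$\|Cx-Cx'\|_{2,2}\le\kappa^2(1+\eta)^2\,\|x-x'\|\,(\|x\|+\|x'\|) .$$ -/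

import Mathlib

open MeasureTheory

noncomputable section

namespace PhaseHarmonic

/-- The domain `ℝ^d` of the signals, with its Euclidean structure. -/
abbrev Space (d : ℕ) : Type := EuclideanSpace ℝ (Fin d)

/-- Phases modulo `2π`. A `2π`-periodic function is a function on this circle, whose measure
`AddCircle.haarAddCircle` is `dα / 2π`. -/
abbrev Phase : Type := AddCircle (2 * Real.pi)

instance fact_two_pi_pos : Fact (0 < 2 * Real.pi) := ⟨Real.two_pi_pos⟩

/-- The Fourier transform `∫ f(u) exp(-i ω·u) du`. -/
def freqResponse {d : ℕ} (f : Space d → ℂ) (ω : Space d) : ℂ :=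
  ∫ u : Space d, Complex.exp (-(Complex.I * ((inner ℝ ω u : ℝ) : ℂ))) * f u

/-- For almost all `ω`,
`(1 - η)^2 ≤ (1/2) ∑_l (|ψ̂_l(ω)|^2 + |ψ̂_l(-ω)|^2) ≤ (1 + η)^2`.
The sum of nonnegative terms is taken in `[0, ∞]`. -/
def LittlewoodPaley {d : ℕ} {Λ : Type*} (ψ : Λ → Space d → ℂ) (η : ℝ) : Prop :=
  ∀ᵐ ω : Space d,
    ENNReal.ofReal ((1 - η) ^ 2) ≤
        2⁻¹ * ∑' l, (‖freqResponse (ψ l) ω‖ₑ ^ 2 + ‖freqResponse (ψ l) (-ω)‖ₑ ^ 2) ∧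
      2⁻¹ * ∑' l, (‖freqResponse (ψ l) ω‖ₑ ^ 2 + ‖freqResponse (ψ l) (-ω)‖ₑ ^ 2) ≤
        ENNReal.ofReal ((1 + η) ^ 2)

/-- The phase filter `H z(α) = |z| h(α - φ(z))`. -/
def phaseFilter (h : Phase → ℂ) (z : ℂ) (α : Phase) : ℂ :=
  (‖z‖ : ℂ) * h (α - ((Complex.arg z : ℝ) : Phase))

/-- The filtered signal `x ⋆ ψ (u) = ∫ x(v) ψ(u - v) dv` for a real signal `x`. -/
def filtered {d : ℕ} (x : Space d → ℝ) (ψ : Space d → ℂ) : Space d → ℂ :=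
  convolution x ψ (ContinuousLinearMap.lsmul ℝ ℝ) volume

/-- The phase harmonic representation
`U x(u, l, α) = |x ⋆ ψ_l(u)| h(α - φ(x ⋆ ψ_l(u)))`. -/
def phaseRep {d : ℕ} {Λ : Type*} (ψ : Λ → Space d → ℂ) (h : Phase → ℂ)
    (x : Space d → ℝ) (u : Space d) (p : Λ × Phase) : ℂ :=
  phaseFilter h (filtered x (ψ p.1) u) p.2

/-- The measure on pairs `(l, α)`: counting measure in `l` and `dα / 2π` in `α`, so that
`‖v‖^2 = (1/2π) ∑_l ∫_0^{2π} |v(l, α)|^2 dα`. -/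
def phaseMeasure (Λ : Type*) [MeasurableSpace Λ] : Measure (Λ × Phase) :=
  (Measure.count : Measure Λ).prod AddCircle.haarAddCircle

/-- The Hilbert space of vectors `v(l, α)`. -/
abbrev PhaseVec (Λ : Type*) [MeasurableSpace Λ] : Type _ :=
  Lp ℂ 2 (phaseMeasure Λ)

/-- `‖h‖^2 = (1/2π) ∫_0^{2π} |h(α)|^2 dα`. -/
def normSqFilter (h : Phase → ℂ) : ℝ :=
  ∫ α : Phase, ‖h α‖ ^ 2 ∂AddCircle.haarAddCircle

/-- `κ`, with `κ^2 = |ĥ(0)|^2 + ∑_k k^2 |ĥ(k)|^2`. It is finite when the series converges. -/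
def kappa (h : Phase → ℂ) : ℝ :=
  Real.sqrt (‖fourierCoeff h 0‖ ^ 2 + ∑' k : ℤ, (k : ℝ) ^ 2 * ‖fourierCoeff h k‖ ^ 2)

/-- The cube `[0, L]^d`. -/
def cube (d : ℕ) (L : ℝ) : Set (Space d) := {u | ∀ i, u i ∈ Set.Icc 0 L}

/-- Coordinatewise reduction modulo `L` to `[0, L)^d`. -/
def reduceMod {d : ℕ} {L : ℝ} (hL : 0 < L) (u : Space d) : Space d :=
  WithLp.toLp 2 fun i => toIcoMod hL 0 (u i)

/-- The `L`-periodic extension to `ℝ^d` of a signal on `[0, L]^d`. Convolving it with `ψ` over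
`ℝ^d` is the periodic convolution with `ψ` over `[0, L]^d`. -/
def periodicExt {d : ℕ} {L : ℝ} (hL : 0 < L) (x : Space d → ℝ) : Space d → ℝ :=
  fun u => x (reduceMod hL u)

/-- The mean vector `M x(l, α) = ∫ U x(u, l, α) du` of a signal on `[0, L]^d`, where the
convolutions are periodic over `[0, L]^d`. -/
def meanVec {d : ℕ} {Λ : Type*} (ψ : Λ → Space d → ℂ) (h : Phase → ℂ) {L : ℝ} (hL : 0 < L)
    (x : Space d → ℝ) (p : Λ × Phase) : ℂ :=
  ∫ u in cube d L, phaseRep ψ h (periodicExt hL x) u p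

/-- The autocorrelation kernel `C x(p, q) = ∫ U x(u, p) U x(u, q)^* du`, for `p = (l, α)` and
`q = (l', α')`. -/
def autocorrKernel {d : ℕ} {Λ : Type*} (ψ : Λ → Space d → ℂ) (h : Phase → ℂ)
    (x : Space d → ℝ) (p q : Λ × Phase) : ℂ :=
  ∫ u : Space d, phaseRep ψ h x u p * (starRingEnd ℂ) (phaseRep ψ h x u q)

/-- `T` is the autocorrelation operator `C x`, that is the bounded operator
`T v(l, α) = (1/2π) ∑_{l'} ∫_0^{2π} C x(l, α, l', α') v(l', α') dα'`. -/
def IsAutocorrOp {d : ℕ} {Λ : Type*} [MeasurableSpace Λ] (ψ : Λ → Space d → ℂ)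
    (h : Phase → ℂ) (x : Space d → ℝ) (T : PhaseVec Λ →L[ℂ] PhaseVec Λ) : Prop :=
  ∀ v : PhaseVec Λ, ∀ᵐ p ∂(phaseMeasure Λ),
    (T v : Λ × Phase → ℂ) p =
      ∫ q, autocorrKernel ψ h x p q * (v : Λ × Phase → ℂ) q ∂(phaseMeasure Λ)

/-- `T` is of trace class with trace `t`: the diagonal coefficients of `T` are summable with sum
`t` in every orthonormal basis. -/
def HasTrace.{u} {H : Type u} [NormedAddCommGroup H] [InnerProductSpace ℂ H] [CompleteSpace H]
    (T : H →L[ℂ] H) (t : ℝ) : Prop :=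
  ∀ (ι : Type u) (b : HilbertBasis ι ℂ H), HasSum (fun i => inner ℂ (b i) (T (b i))) (t : ℂ)

end PhaseHarmonic

end

/-! Everything follows from treating Ux as one function of (u, (λ, α)) and estimating it in L² of
the product measure. At a fixed complex value z, the phase filter Hz(α) = |z| h(α - φ(z)) has norm
|z| ‖h‖ by rotation invariance, and its k-th Fourier coefficient is |z| exp(-ikφ(z)) ĥ(k). The map z
↦ |z| exp(ikφ(z)) is Lipschitz with constant max(1, |k|), so Parseval makes z ↦ Hz Lipschitz with
constant κ (`lintegral_phaseFilter_sub_sq_le`). Plancherel turns the total energy of the x ⋆ ψ_λ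
into an integral of |x̂|² against ∑|ψ̂_λ|². As x is real, ψ_λ and its conjugate give the same
energy, which produces the symmetrised Littlewood–Paley sum (`tsum_energy_eq`). Hence x ↦ Ux is
κ(1+η)-Lipschitz into L², and ‖Ux‖² lies between (1∓η)²‖h‖²‖x‖². The torus is handled in the same
way with Fourier series; `convAlong` serves both settings, with π the identity or the reduction
modulo L. The mean costs a factor L^(d/2) by Cauchy–Schwarz on the cube. The operator Cx is A*A,
where A is the Hilbert–Schmidt operator with kernel the conjugate of Ux: its trace is ‖Ux‖²
(`hasTrace_gramOp`), and A*A - B*B = A*(A - B) + (A - B)*B gives the last estimate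
(`norm_gramOp_sub_le`). -/

namespace PhaseHarmonic

open scoped ENNReal

/-! ### Square integrals and Cauchy–Schwarz in [0, ∞]. -/

section SquareIntegrals

variable {α β E : Type*} [MeasurableSpace α] [MeasurableSpace β] [NormedAddCommGroup E]
  {μ : Measure α} {ν : Measure β}

theorem eLpNorm_two_sq (f : α → E) : eLpNorm f 2 μ ^ 2 = ∫⁻ a, ‖f a‖ₑ ^ 2 ∂μ := by
  have := eLpNorm_nnreal_pow_eq_lintegral (f := f) (μ := μ) (p := 2) two_ne_zero
  simpa using this

theorem memLp_two_iff_lintegral {f : α → E} (hf : AEStronglyMeasurable f μ) :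
    MemLp f 2 μ ↔ ∫⁻ a, ‖f a‖ₑ ^ 2 ∂μ < ⊤ := by
  rw [← eLpNorm_two_sq]
  constructor
  · exact fun h => ENNReal.pow_lt_top h.2
  · intro h
    refine ⟨hf, ?_⟩
    by_contra hc
    simp only [not_lt, top_le_iff] at hc
    simp [hc] at h

theorem lintegral_lt_top_of_memLp_two {f : α → E} (hf : MemLp f 2 μ) :
    ∫⁻ a, ‖f a‖ₑ ^ 2 ∂μ < ⊤ :=
  (memLp_two_iff_lintegral hf.1).1 hf

theorem enorm_Lp_two_sq (f : Lp E 2 μ) : ‖f‖ₑ ^ 2 = ∫⁻ a, ‖f a‖ₑ ^ 2 ∂μ := by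
  rw [Lp.enorm_def, eLpNorm_two_sq]

theorem lintegral_mul_sq_le {f g : α → ℝ≥0∞} (hf : AEMeasurable f μ) (hg : AEMeasurable g μ) :
    (∫⁻ a, f a * g a ∂μ) ^ 2 ≤ (∫⁻ a, f a ^ 2 ∂μ) * ∫⁻ a, g a ^ 2 ∂μ := by
  have h := ENNReal.lintegral_mul_le_Lp_mul_Lq μ Real.HolderConjugate.two_two hf hg
  simp only [Pi.mul_apply, ENNReal.rpow_ofNat] at h
  refine (pow_le_pow_left' h 2).trans_eq ?_
  rw [mul_pow, ← ENNReal.rpow_two, ← ENNReal.rpow_two, ← ENNReal.rpow_mul, ← ENNReal.rpow_mul]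
  norm_num

theorem enorm_integral_mul_sq_le {f g : α → ℂ} (hf : AEStronglyMeasurable f μ)
    (hg : AEStronglyMeasurable g μ) :
    ‖∫ a, f a * g a ∂μ‖ₑ ^ 2 ≤ (∫⁻ a, ‖f a‖ₑ ^ 2 ∂μ) * ∫⁻ a, ‖g a‖ₑ ^ 2 ∂μ := by
  refine le_trans (pow_le_pow_left' (enorm_integral_le_lintegral_enorm _) 2) ?_
  simp only [enorm_mul]
  exact lintegral_mul_sq_le hf.enorm hg.enorm

theorem memLp_two_tensor [SFinite ν] {f : α → ℂ} {g : β → ℂ} (hf : MemLp f 2 μ)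
    (hg : MemLp g 2 ν) : MemLp (fun z : α × β => f z.1 * g z.2) 2 (μ.prod ν) := by
  have hm : AEStronglyMeasurable (fun z : α × β => f z.1 * g z.2) (μ.prod ν) :=
    hf.1.comp_fst.mul hg.1.comp_snd
  rw [memLp_two_iff_lintegral hm]
  simp only [enorm_mul, mul_pow]
  rw [lintegral_prod_mul (hf.1.enorm.pow_const 2) (hg.1.enorm.pow_const 2)]
  exact ENNReal.mul_lt_top (lintegral_lt_top_of_memLp_two hf) (lintegral_lt_top_of_memLp_two hg)

theorem memLp_two_conj {f : α → ℂ} (hf : MemLp f 2 μ) :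
    MemLp (fun a => (starRingEnd ℂ) (f a)) 2 μ :=
  hf.star

theorem integrable_mul_of_memLp_two {f g : α → ℂ} (hf : MemLp f 2 μ) (hg : MemLp g 2 μ) :
    Integrable (fun a => f a * g a) μ :=
  MemLp.integrable_mul hf hg

theorem memLp_two_ae_left [SFinite ν] {F : α × β → ℂ} (hF : MemLp F 2 (μ.prod ν)) :
    ∀ᵐ a ∂μ, MemLp (fun b => F (a, b)) 2 ν := by
  have h1 := lintegral_lt_top_of_memLp_two hF
  rw [lintegral_prod _ (hF.1.enorm.pow_const 2)] at h1
  filter_upwards [ae_lt_top' ((hF.1.enorm.pow_const 2).lintegral_prod_right') h1.ne,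
    hF.1.prodMk_left] with a ha hm
  exact (memLp_two_iff_lintegral hm).2 ha

theorem memLp_two_swap [SFinite μ] [SFinite ν] {F : α × β → ℂ} (hF : MemLp F 2 (μ.prod ν)) :
    MemLp (fun z : β × α => F z.swap) 2 (ν.prod μ) :=
  hF.comp_measurePreserving Measure.measurePreserving_swap

end SquareIntegrals

/-! ### Hilbert–Schmidt operators and their Gram operators. -/

section KernelOperators

variable {α β : Type*} [MeasurableSpace α] [MeasurableSpace β]
  {μ : Measure α} {ν : Measure β} [SFinite ν]

/-- Cauchy–Schwarz in each row, then Tonelli: the operator norm is at most the Hilbert–Schmidt norm.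
-/
theorem lintegral_kernel_sq_le {F : α × β → ℂ} (hF : MemLp F 2 (μ.prod ν)) {v : β → ℂ}
    (hv : MemLp v 2 ν) :
    ∫⁻ a, ‖∫ b, F (a, b) * v b ∂ν‖ₑ ^ 2 ∂μ ≤
      (∫⁻ z, ‖F z‖ₑ ^ 2 ∂(μ.prod ν)) * ∫⁻ b, ‖v b‖ₑ ^ 2 ∂ν := by
  rw [lintegral_prod _ (hF.1.enorm.pow_const 2),
    ← lintegral_mul_const'' _ ((hF.1.enorm.pow_const 2).lintegral_prod_right')]
  refine lintegral_mono_ae ?_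
  filter_upwards [memLp_two_ae_left hF] with a ha
  exact enorm_integral_mul_sq_le ha.1 hv.1

theorem memLp_kernel {F : α × β → ℂ} (hF : MemLp F 2 (μ.prod ν)) {v : β → ℂ}
    (hv : MemLp v 2 ν) : MemLp (fun a => ∫ b, F (a, b) * v b ∂ν) 2 μ := by
  have hm : AEStronglyMeasurable (fun a => ∫ b, F (a, b) * v b ∂ν) μ :=
    (hF.1.mul hv.1.comp_snd).integral_prod_right'
  rw [memLp_two_iff_lintegral hm]
  exact (lintegral_kernel_sq_le hF hv).trans_lt
    (ENNReal.mul_lt_top (lintegral_lt_top_of_memLp_two hF) (lintegral_lt_top_of_memLp_two hv))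

/-- The Hilbert–Schmidt operator with kernel `F`. -/
noncomputable def kernelOp (F : α × β → ℂ) (hF : MemLp F 2 (μ.prod ν)) :
    Lp ℂ 2 ν →L[ℂ] Lp ℂ 2 μ :=
  LinearMap.mkContinuous
    { toFun := fun v => (memLp_kernel hF (Lp.memLp v)).toLp _
      map_add' := fun v w => by
        rw [← MemLp.toLp_add]
        refine MemLp.toLp_congr _ _ ?_
        filter_upwards [memLp_two_ae_left hF] with a ha
        simp only [Pi.add_apply]
        rw [← integral_add (integrable_mul_of_memLp_two ha (Lp.memLp v))
          (integrable_mul_of_memLp_two ha (Lp.memLp w))]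
        refine integral_congr_ae ?_
        filter_upwards [Lp.coeFn_add v w] with b hb
        rw [hb, Pi.add_apply, mul_add]
      map_smul' := fun c v => by
        rw [RingHom.id_apply, ← MemLp.toLp_const_smul]
        refine MemLp.toLp_congr _ _ (Filter.Eventually.of_forall fun a => ?_)
        simp only [Pi.smul_apply]
        rw [← integral_smul]
        refine integral_congr_ae ?_
        filter_upwards [Lp.coeFn_smul c v] with b hb
        simp only [hb, Pi.smul_apply, smul_eq_mul]
        ring }
    (eLpNorm F 2 (μ.prod ν)).toReal (fun v => by
      have h := lintegral_kernel_sq_le hF (Lp.memLp v)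
      rw [← eLpNorm_two_sq, ← eLpNorm_two_sq, ← eLpNorm_two_sq, ← mul_pow] at h
      have h' := (ENNReal.pow_le_pow_left_iff two_ne_zero).1 h
      rw [LinearMap.coe_mk, AddHom.coe_mk, Lp.norm_toLp, Lp.norm_def, ← ENNReal.toReal_mul]
      exact ENNReal.toReal_mono (ENNReal.mul_ne_top hF.2.ne (Lp.memLp v).2.ne) h')

theorem kernelOp_apply {F : α × β → ℂ} (hF : MemLp F 2 (μ.prod ν)) (v : Lp ℂ 2 ν) :
    kernelOp F hF v =ᵐ[μ] fun a => ∫ b, F (a, b) * v b ∂ν :=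
  MemLp.coeFn_toLp (memLp_kernel hF (Lp.memLp v))

theorem norm_kernelOp_le {F : α × β → ℂ} (hF : MemLp F 2 (μ.prod ν)) :
    ‖kernelOp F hF‖ ≤ (eLpNorm F 2 (μ.prod ν)).toReal :=
  LinearMap.mkContinuous_norm_le _ ENNReal.toReal_nonneg _

theorem kernelOp_sub {F G : α × β → ℂ} (hF : MemLp F 2 (μ.prod ν)) (hG : MemLp G 2 (μ.prod ν)) :
    kernelOp F hF - kernelOp G hG = kernelOp (F - G) (hF.sub hG) := by
  ext1 v
  apply Lp.ext
  filter_upwards [kernelOp_apply hF v, kernelOp_apply hG v, kernelOp_apply (hF.sub hG) v,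
    Lp.coeFn_sub (kernelOp F hF v) (kernelOp G hG v), memLp_two_ae_left hF,
    memLp_two_ae_left hG] with a h1 h2 h3 h4 h5 h6
  rw [sub_apply, h4, Pi.sub_apply, h1, h2, h3,
    ← integral_sub (integrable_mul_of_memLp_two h5 (Lp.memLp v))
      (integrable_mul_of_memLp_two h6 (Lp.memLp v))]
  simp only [Pi.sub_apply, sub_mul]

/-- The kernel of the adjoint. -/
def adjKernel (F : α × β → ℂ) (z : β × α) : ℂ := (starRingEnd ℂ) (F z.swap)

theorem memLp_adjKernel [SFinite μ] {F : α × β → ℂ} (hF : MemLp F 2 (μ.prod ν)) :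
    MemLp (adjKernel F) 2 (ν.prod μ) :=
  memLp_two_conj (memLp_two_swap hF)

theorem kernelOp_adjoint [SFinite μ] {F : α × β → ℂ} (hF : MemLp F 2 (μ.prod ν)) :
    ContinuousLinearMap.adjoint (kernelOp F hF) = kernelOp (adjKernel F) (memLp_adjKernel hF) := by
  symm
  rw [ContinuousLinearMap.eq_adjoint_iff]
  intro g v
  rw [L2.inner_def, L2.inner_def]
  have h1 : ∫ b, inner ℂ (kernelOp (adjKernel F) (memLp_adjKernel hF) g b) (v b) ∂ν =
      ∫ b, ∫ a, F (a, b) * ((starRingEnd ℂ) (g a) * v b) ∂μ ∂ν := by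
    refine integral_congr_ae ?_
    filter_upwards [kernelOp_apply (memLp_adjKernel hF) g] with b hb
    rw [hb, RCLike.inner_apply, ← integral_conj, ← integral_const_mul]
    refine integral_congr_ae (Filter.Eventually.of_forall fun a => ?_)
    simp only [adjKernel, Prod.swap_prod_mk, map_mul, Complex.conj_conj]
    ring
  have h2 : ∫ a, inner ℂ (g a) (kernelOp F hF v a) ∂μ =
      ∫ a, ∫ b, F (a, b) * ((starRingEnd ℂ) (g a) * v b) ∂ν ∂μ := by
    refine integral_congr_ae ?_
    filter_upwards [kernelOp_apply hF v] with a ha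
    rw [ha, RCLike.inner_apply, mul_comm, ← integral_const_mul]
    refine integral_congr_ae (Filter.Eventually.of_forall fun b => ?_)
    simp only
    ring
  rw [h1, h2]
  -- Fubini applies because the integrand is the product of `F` and the tensor of `g` conjugate and
  -- `v`, both in L² of the product.
  refine (integral_integral_swap ?_).symm
  exact integrable_mul_of_memLp_two hF
    (memLp_two_tensor (memLp_two_conj (Lp.memLp g)) (Lp.memLp v))

/-- The operator with kernel `∫ F(a, p) F(a, q)^* da`. -/
noncomputable def gramOp (F : α × β → ℂ) (hF : MemLp F 2 (μ.prod ν)) :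
    Lp ℂ 2 ν →L[ℂ] Lp ℂ 2 ν :=
  (ContinuousLinearMap.adjoint (kernelOp _ (memLp_two_conj hF))).comp
    (kernelOp _ (memLp_two_conj hF))

/-- For almost every `p` the column `F (·, p)` is in L², so its tensor with `v` is in L² and the
integrals over `a` and `q` may be exchanged. -/
theorem gramOp_apply [SFinite μ] {F : α × β → ℂ} (hF : MemLp F 2 (μ.prod ν)) (v : Lp ℂ 2 ν) :
    gramOp F hF v =ᵐ[ν] fun p =>
      ∫ q, (∫ a, F (a, p) * (starRingEnd ℂ) (F (a, q)) ∂μ) * v q ∂ν := by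
  rw [gramOp, kernelOp_adjoint]
  filter_upwards [kernelOp_apply (memLp_adjKernel (memLp_two_conj hF))
      (kernelOp _ (memLp_two_conj hF) v), memLp_two_ae_left (memLp_two_swap hF)] with p hp hFp
  rw [ContinuousLinearMap.comp_apply, hp]
  simp only [Prod.swap_prod_mk] at hFp
  have h1 : ∫ a, adjKernel (fun z => (starRingEnd ℂ) (F z)) (p, a) *
      kernelOp _ (memLp_two_conj hF) v a ∂μ =
      ∫ a, ∫ q, (F (a, p) * v q) * (starRingEnd ℂ) (F (a, q)) ∂ν ∂μ := by
    refine integral_congr_ae ?_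
    filter_upwards [kernelOp_apply (memLp_two_conj hF) v] with a ha
    rw [ha, ← integral_const_mul]
    refine integral_congr_ae (Filter.Eventually.of_forall fun b => ?_)
    simp only [adjKernel, Prod.swap_prod_mk, Complex.conj_conj]
    ring
  rw [h1, integral_integral_swap]
  · refine integral_congr_ae (Filter.Eventually.of_forall fun q => ?_)
    simp only
    rw [← integral_mul_const]
    refine integral_congr_ae (Filter.Eventually.of_forall fun a => ?_)
    simp only
    ring
  · exact integrable_mul_of_memLp_two (memLp_two_tensor hFp (Lp.memLp v)) (memLp_two_conj hF)

theorem norm_gramOp_sub_le {F G : α × β → ℂ} (hF : MemLp F 2 (μ.prod ν))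
    (hG : MemLp G 2 (μ.prod ν)) :
    ‖gramOp F hF - gramOp G hG‖ ≤ (eLpNorm (F - G) 2 (μ.prod ν)).toReal *
      ((eLpNorm F 2 (μ.prod ν)).toReal + (eLpNorm G 2 (μ.prod ν)).toReal) := by
  set A := kernelOp _ (memLp_two_conj hF) with hA
  set B := kernelOp _ (memLp_two_conj hG) with hB
  have hconj : ∀ H : α × β → ℂ, eLpNorm (fun z => (starRingEnd ℂ) (H z)) 2 (μ.prod ν) =
      eLpNorm H 2 (μ.prod ν) := fun H => eLpNorm_congr_norm_ae (by simp)
  have h1 : ‖A‖ ≤ (eLpNorm F 2 (μ.prod ν)).toReal := by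
    rw [← hconj]; exact norm_kernelOp_le _
  have h2 : ‖B‖ ≤ (eLpNorm G 2 (μ.prod ν)).toReal := by
    rw [← hconj]; exact norm_kernelOp_le _
  have h3 : ‖A - B‖ ≤ (eLpNorm (F - G) 2 (μ.prod ν)).toReal := by
    rw [hA, hB, kernelOp_sub, ← hconj]
    refine (norm_kernelOp_le _).trans_eq ?_
    congr 2
    ext z
    simp
  -- Telescoping A*A - B*B leaves a single factor A - B in each term; taking adjoints preserves the
  -- norm.
  have h4 : gramOp F hF - gramOp G hG = (ContinuousLinearMap.adjoint A).comp (A - B) +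
      (ContinuousLinearMap.adjoint (A - B)).comp B := by
    rw [gramOp, gramOp, map_sub, ContinuousLinearMap.sub_comp, ContinuousLinearMap.comp_sub]
    abel
  rw [h4]
  have h5 := ContinuousLinearMap.opNorm_comp_le (ContinuousLinearMap.adjoint A) (A - B)
  have h6 := ContinuousLinearMap.opNorm_comp_le (ContinuousLinearMap.adjoint (A - B)) B
  rw [LinearIsometryEquiv.norm_map] at h5 h6
  have h7 := norm_nonneg A
  have h8 := norm_nonneg B
  have h9 := norm_nonneg (A - B)
  calc _ ≤ ‖A‖ * ‖A - B‖ + ‖A - B‖ * ‖B‖ := (norm_add_le _ _).trans (add_le_add h5 h6)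
    _ = ‖A - B‖ * (‖A‖ + ‖B‖) := by ring
    _ ≤ _ := by gcongr

end KernelOperators

/-! ### The trace of a Gram operator. -/

section Trace

/-- Orthonormal vectors are √2 apart, so balls of radius 1/2 around them are disjoint open sets in a
separable space. Countability lets the trace sum be exchanged with integrals and with
almost-everywhere statements. -/
theorem countable_of_orthonormal {ι H : Type*} [NormedAddCommGroup H] [InnerProductSpace ℂ H]
    [TopologicalSpace.SeparableSpace H] {b : ι → H} (hb : Orthonormal ℂ b) : Countable ι := by
  have hd : Pairwise (Function.onFun Disjoint fun i => Metric.ball (b i) (1 / 2)) := by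
    intro i j hij
    refine Metric.ball_disjoint_ball ?_
    have h : dist (b i) (b j) ^ 2 = 2 := by
      rw [dist_eq_norm, @norm_sub_sq ℂ, hb.1, hb.1, hb.2 hij]
      norm_num
    nlinarith [dist_nonneg (x := b i) (y := b j)]
  have := Set.PairwiseDisjoint.countable_of_isOpen (s := fun i => Metric.ball (b i) (1 / 2))
    (a := Set.univ) (fun i _ j _ hij => hd hij) (fun i _ => Metric.isOpen_ball)
    (fun i _ => ⟨b i, by simp⟩)
  exact Set.countable_univ_iff.1 this

theorem tsum_enorm_inner_sq {ι H : Type*} [NormedAddCommGroup H] [InnerProductSpace ℂ H]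
    (b : HilbertBasis ι ℂ H) (x : H) :
    ∑' i, ‖(inner ℂ x (b i) : ℂ)‖ₑ ^ 2 = ‖x‖ₑ ^ 2 := by
  have h := b.hasSum_inner_mul_inner x x
  have h' : HasSum (fun i => ‖(inner ℂ x (b i) : ℂ)‖ ^ 2) (‖x‖ ^ 2) := by
    rw [← Complex.hasSum_ofReal]
    have h1 : ((‖x‖ ^ 2 : ℝ) : ℂ) = inner ℂ x x := by
      rw [inner_self_eq_norm_sq_to_K]
      simp
    rw [h1]
    refine h.congr_fun fun i => ?_
    rw [← inner_conj_symm (b i) x, Complex.mul_conj, Complex.normSq_eq_norm_sq]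
  have h'' := h'.tsum_eq
  rw [← ofReal_norm, ← ENNReal.ofReal_pow (norm_nonneg _), ← h'',
    ENNReal.ofReal_tsum_of_nonneg (fun _ => by positivity) h'.summable]
  refine tsum_congr fun i => ?_
  rw [← ofReal_norm, ← ENNReal.ofReal_pow (norm_nonneg _)]

variable {α β : Type*} [MeasurableSpace α] [MeasurableSpace β]
  {μ : Measure α} {ν : Measure β} [SFinite ν]

/-- The diagonal coefficients are ‖A bᵢ‖², and A bᵢ(a) is the inner product of the row F(a, ·) with
bᵢ. Summing over i at fixed a is Parseval for that row; integrating over a then gives ‖F‖² in every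
basis. -/
theorem hasTrace_gramOp [MeasurableSpace.CountablyGenerated β] {F : α × β → ℂ}
    (hF : MemLp F 2 (μ.prod ν)) :
    HasTrace (gramOp F hF) (∫⁻ z, ‖F z‖ₑ ^ 2 ∂(μ.prod ν)).toReal := by
  intro ι b
  have : Fact ((2 : ℝ≥0∞) ≠ ⊤) := ⟨ENNReal.ofNat_ne_top⟩
  have : Countable ι := countable_of_orthonormal b.orthonormal
  set A := kernelOp _ (memLp_two_conj hF) with hA
  have h1 : ∀ i, inner ℂ (b i) (gramOp F hF (b i)) = ((‖A (b i)‖ ^ 2 : ℝ) : ℂ) := by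
    intro i
    rw [gramOp, ContinuousLinearMap.comp_apply, ContinuousLinearMap.adjoint_inner_right,
      inner_self_eq_norm_sq_to_K]
    simp [hA]
  simp only [h1]
  rw [Complex.hasSum_ofReal]
  have h2 : ∑' i, ‖A (b i)‖ₑ ^ 2 = ∫⁻ z, ‖F z‖ₑ ^ 2 ∂(μ.prod ν) := by
    simp only [enorm_Lp_two_sq]
    rw [← lintegral_tsum (fun i => (Lp.aestronglyMeasurable _).enorm.pow_const 2),
      lintegral_prod _ (hF.1.enorm.pow_const 2)]
    refine lintegral_congr_ae ?_
    filter_upwards [ae_all_iff.2 fun i => kernelOp_apply (memLp_two_conj hF) (b i),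
      memLp_two_ae_left hF] with a ha hFa
    have h3 := tsum_enorm_inner_sq b (hFa.toLp _)
    rw [Lp.enorm_toLp, eLpNorm_two_sq] at h3
    rw [← h3]
    refine tsum_congr fun i => ?_
    rw [hA, ha, L2.inner_def]
    congr 2
    refine integral_congr_ae ?_
    filter_upwards [hFa.coeFn_toLp] with q hq
    rw [hq, RCLike.inner_apply, mul_comm]
  have h4 : (∑' i, ENNReal.ofReal (‖A (b i)‖ ^ 2)) = ∫⁻ z, ‖F z‖ₑ ^ 2 ∂(μ.prod ν) := by
    rw [← h2]
    refine tsum_congr fun i => ?_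
    rw [← ofReal_norm, ENNReal.ofReal_pow (norm_nonneg _)]
  have h5 := lintegral_lt_top_of_memLp_two hF
  rw [← h4] at h5 ⊢
  have h6 := ENNReal.hasSum_toReal h5.ne
  rw [ENNReal.tsum_toReal_eq (fun _ => ENNReal.ofReal_ne_top)]
  simpa [ENNReal.toReal_ofReal] using h6

end Trace

/-! ### Means over a finite measure. -/

section MeanVector

variable {α β : Type*} [MeasurableSpace α] [MeasurableSpace β]
  {μ : Measure α} {ν : Measure β} [IsFiniteMeasure μ] [SFinite ν]

theorem memLp_mean {F : α × β → ℂ} (hF : MemLp F 2 (μ.prod ν)) :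
    MemLp (fun b => ∫ a, F (a, b) ∂μ) 2 ν := by
  simpa using memLp_kernel (memLp_two_swap hF) (memLp_const (1 : ℂ))

/-- The mean is the kernel operator applied to the constant 1, whose squared norm is the total mass.
On the cube this mass is L^d. -/
theorem lintegral_mean_sq_le {F : α × β → ℂ} (hF : MemLp F 2 (μ.prod ν)) :
    ∫⁻ b, ‖∫ a, F (a, b) ∂μ‖ₑ ^ 2 ∂ν ≤ μ Set.univ * ∫⁻ z, ‖F z‖ₑ ^ 2 ∂(μ.prod ν) := by
  have h := lintegral_kernel_sq_le (memLp_two_swap hF) (memLp_const (1 : ℂ))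
  simp only [Prod.swap_prod_mk, mul_one, enorm_one, one_pow, lintegral_const, one_mul] at h
  rw [mul_comm]
  refine h.trans_eq ?_
  congr 1
  exact Measure.measurePreserving_swap.lintegral_comp_emb
    MeasurableEquiv.prodComm.measurableEmbedding (fun z => ‖F z‖ₑ ^ 2)

end MeanVector

/-! ### Fourier coefficients in the phase variable. -/

section Parseval

theorem tsum_enorm_fourierCoeff_sq {f : Phase → ℂ} (hf : MemLp f 2 AddCircle.haarAddCircle) :
    ∑' k : ℤ, ‖fourierCoeff f k‖ₑ ^ 2 = ∫⁻ a, ‖f a‖ₑ ^ 2 ∂AddCircle.haarAddCircle := by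
  have h := hasSum_sq_fourierCoeff (hf.toLp f)
  have hc : fourierCoeff (hf.toLp f) = fourierCoeff f := fourierCoeff_congr_ae hf.coeFn_toLp
  have hi : ∫ t, ‖hf.toLp f t‖ ^ 2 ∂AddCircle.haarAddCircle =
      ∫ t, ‖f t‖ ^ 2 ∂AddCircle.haarAddCircle := by
    refine integral_congr_ae ?_
    filter_upwards [hf.coeFn_toLp] with t ht
    rw [ht]
  rw [hc, hi] at h
  have h1 : ∀ z : ℂ, ‖z‖ₑ ^ 2 = ENNReal.ofReal (‖z‖ ^ 2) := fun z => by
    rw [← ofReal_norm, ENNReal.ofReal_pow (norm_nonneg _)]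
  simp only [h1]
  rw [← ENNReal.ofReal_tsum_of_nonneg (fun _ => by positivity) h.summable, h.tsum_eq,
    ofReal_integral_eq_lintegral_ofReal]
  · exact (memLp_two_iff_integrable_sq_norm hf.1).1 hf
  · exact Filter.Eventually.of_forall fun _ => by positivity

theorem normSqFilter_eq {h : Phase → ℂ} (hh : MemLp h 2 AddCircle.haarAddCircle) :
    ENNReal.ofReal (normSqFilter h) = ∫⁻ a, ‖h a‖ₑ ^ 2 ∂AddCircle.haarAddCircle := by
  rw [normSqFilter, ofReal_integral_eq_lintegral_ofReal]
  · refine lintegral_congr fun a => ?_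
    rw [← ofReal_norm, ENNReal.ofReal_pow (norm_nonneg _)]
  · exact (memLp_two_iff_integrable_sq_norm hh.1).1 hh
  · exact Filter.Eventually.of_forall fun _ => by positivity

/-- Translation by the phase of `z` becomes modulation of the coefficients. -/
theorem fourierCoeff_phaseFilter (h : Phase → ℂ) (z : ℂ) (k : ℤ) :
    fourierCoeff (phaseFilter h z) k =
      ‖z‖ * fourier (-k) ((Complex.arg z : ℝ) : Phase) * fourierCoeff h k := by
  set c : Phase := ((Complex.arg z : ℝ) : Phase) with hc
  have h1 : ∀ t : Phase, fourier (-k) t • phaseFilter h z t =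
      (‖z‖ * fourier (-k) c) * (fourier (-k) (t - c) • h (t - c)) := by
    intro t
    have : fourier (-k) t = (fourier (-k) c * fourier (-k) (t - c) : ℂ) := by
      simp only [fourier_apply, ← Circle.coe_mul, ← AddCircle.toCircle_add, ← smul_add,
        add_sub_cancel]
    rw [this, phaseFilter]
    simp only [smul_eq_mul, ← hc]
    ring
  simp only [fourierCoeff, h1]
  rw [integral_const_mul, integral_sub_right_eq_self (fun t => fourier (-k) t • h t) c]

theorem norm_pow_sub_pow_le_of_norm_one {w w' : ℂ} (hw : ‖w‖ = 1) (hw' : ‖w'‖ = 1) (n : ℕ) :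
    ‖w ^ n - w' ^ n‖ ≤ n * ‖w - w'‖ := by
  induction n with
  | zero => simp
  | succ n ih =>
    have h1 : w ^ (n + 1) - w' ^ (n + 1) = (w ^ n - w' ^ n) * w + w' ^ n * (w - w') := by ring
    rw [h1]
    refine (norm_add_le _ _).trans ?_
    rw [norm_mul, norm_mul, norm_pow, hw, hw', one_pow, mul_one, one_mul]
    push_cast
    linarith

theorem norm_fourier_sub_le (k : ℤ) (a b : Phase) :
    ‖(fourier k a : ℂ) - fourier k b‖ ≤
      |(k : ℝ)| * ‖(fourier 1 a : ℂ) - fourier 1 b‖ := by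
  have hnat : ∀ n : ℕ, ‖(fourier (n : ℤ) a : ℂ) - fourier (n : ℤ) b‖ ≤
      n * ‖(fourier 1 a : ℂ) - fourier 1 b‖ := by
    intro n
    have h1 : ∀ c : Phase, (fourier (n : ℤ) c : ℂ) = (fourier 1 c : ℂ) ^ n := by
      intro c
      simp only [fourier_apply, AddCircle.toCircle_zsmul, zpow_natCast, Circle.coe_pow, one_smul]
    rw [h1, h1]
    exact norm_pow_sub_pow_le_of_norm_one (by simp [fourier_apply, Circle.norm_coe]) (by simp [fourier_apply, Circle.norm_coe]) n
  obtain ⟨n, rfl | rfl⟩ := k.eq_nat_or_neg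
  · simpa using hnat n
  · rw [fourier_neg, fourier_neg, ← map_sub, RCLike.norm_conj]
    simpa using hnat n

/-- This separates a radial and an angular part, so that replacing w by its k-th power affects the
angular part only. -/
theorem norm_smul_sub_smul_sq {w w' : ℂ} (hw : ‖w‖ = 1) (hw' : ‖w'‖ = 1) (r s : ℝ) :
    ‖(r : ℂ) * w - s * w'‖ ^ 2 = (r - s) ^ 2 + r * s * ‖w - w'‖ ^ 2 := by
  have h1 : w.re ^ 2 + w.im ^ 2 = 1 := by
    have := Complex.sq_norm w
    rw [hw, Complex.normSq_apply] at this
    linarith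
  have h2 : w'.re ^ 2 + w'.im ^ 2 = 1 := by
    have := Complex.sq_norm w'
    rw [hw', Complex.normSq_apply] at this
    linarith
  rw [Complex.sq_norm, Complex.sq_norm, Complex.normSq_apply, Complex.normSq_apply]
  simp only [Complex.sub_re, Complex.sub_im, Complex.re_ofReal_mul, Complex.im_ofReal_mul]
  linear_combination (r ^ 2 - r * s) * h1 + (s ^ 2 - r * s) * h2

theorem norm_mul_fourier_arg (z : ℂ) :
    (‖z‖ : ℂ) * fourier 1 ((Complex.arg z : ℝ) : Phase) = z := by
  rw [fourier_coe_apply]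
  convert Complex.norm_mul_exp_arg_mul_I z using 3
  have : (Real.pi : ℂ) ≠ 0 := by exact_mod_cast Real.pi_ne_zero
  push_cast
  field_simp

/-- Passing from exponent 1 to k multiplies the angular part by at most k². If k ≠ 0 then k² ≥ 1
also covers the radial part; if k = 0 the radial part alone remains, with constant 1. This is the
origin of the extra term |ĥ(0)|² in κ². -/
theorem norm_phase_power_sub_sq_le (k : ℤ) (z z' : ℂ) :
    ‖(‖z‖ : ℂ) * fourier k ((Complex.arg z : ℝ) : Phase) -
        ‖z'‖ * fourier k ((Complex.arg z' : ℝ) : Phase)‖ ^ 2 ≤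
      ((if k = 0 then 1 else 0) + (k : ℝ) ^ 2) * ‖z - z'‖ ^ 2 := by
  have hun : ∀ (j : ℤ) (a : Phase), ‖(fourier j a : ℂ)‖ = 1 := fun j a => by simp [fourier_apply, Circle.norm_coe]
  set a : Phase := ((Complex.arg z : ℝ) : Phase) with ha
  set b : Phase := ((Complex.arg z' : ℝ) : Phase) with hb
  have hz : ‖z - z'‖ ^ 2 = (‖z‖ - ‖z'‖) ^ 2 +
      ‖z‖ * ‖z'‖ * ‖(fourier 1 a : ℂ) - fourier 1 b‖ ^ 2 := by
    rw [← norm_smul_sub_smul_sq (hun 1 a) (hun 1 b), ha, hb, norm_mul_fourier_arg,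
      norm_mul_fourier_arg]
  have hr : 0 ≤ ‖z‖ * ‖z'‖ := by positivity
  rw [norm_smul_sub_smul_sq (hun k a) (hun k b), hz]
  have hk := norm_fourier_sub_le k a b
  have hk2 : ‖(fourier k a : ℂ) - fourier k b‖ ^ 2 ≤
      (k : ℝ) ^ 2 * ‖(fourier 1 a : ℂ) - fourier 1 b‖ ^ 2 := by
    rw [← sq_abs (k : ℝ), ← mul_pow]
    exact pow_le_pow_left₀ (norm_nonneg _) hk 2
  have hk3 := mul_le_mul_of_nonneg_left hk2 hr
  by_cases h0 : k = 0
  · subst h0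
    simp only [fourier_zero, sub_self, norm_zero]
    simp
    positivity
  · have h1 : (1 : ℝ) ≤ (k : ℝ) ^ 2 := by
      have : (1 : ℤ) ≤ k ^ 2 := by
        have := sq_nonneg k
        have : k ^ 2 ≠ 0 := by positivity
        omega
      exact_mod_cast this
    rw [if_neg h0]
    nlinarith [sq_nonneg (‖z‖ - ‖z'‖)]

end Parseval

/-! ### Norm and Lipschitz bound of the phase filter, for values and for families. -/

section PhaseFilter

theorem measurePreserving_phase_sub (c : Phase) :
    MeasurePreserving (fun a : Phase => a - c) AddCircle.haarAddCircle AddCircle.haarAddCircle :=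
  measurePreserving_sub_right _ c

theorem memLp_phaseFilter {h : Phase → ℂ} (hh : MemLp h 2 AddCircle.haarAddCircle) (z : ℂ) :
    MemLp (phaseFilter h z) 2 AddCircle.haarAddCircle :=
  (hh.comp_measurePreserving (measurePreserving_phase_sub _)).const_mul _

theorem lintegral_phaseFilter_sq (h : Phase → ℂ) (hh : MemLp h 2 AddCircle.haarAddCircle) (z : ℂ) :
    ∫⁻ a, ‖phaseFilter h z a‖ₑ ^ 2 ∂AddCircle.haarAddCircle =
      ‖z‖ₑ ^ 2 * ENNReal.ofReal (normSqFilter h) := by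
  have h1 : ∀ a, ‖phaseFilter h z a‖ₑ ^ 2 =
      ‖z‖ₑ ^ 2 * ‖h (a - ((Complex.arg z : ℝ) : Phase))‖ₑ ^ 2 := fun a => by
    have h0 : ‖(‖z‖ : ℂ)‖ₑ = ‖z‖ₑ := enorm_eq_iff_norm_eq.2 (by simp)
    rw [phaseFilter, enorm_mul, mul_pow, h0]
  simp_rw [h1]
  rw [lintegral_const_mul' _ _ (by finiteness),
    lintegral_sub_right_eq_self (fun a => ‖h a‖ₑ ^ 2), normSqFilter_eq hh]

theorem kappa_sq_eq {h : Phase → ℂ}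
    (hs : Summable fun k : ℤ => (k : ℝ) ^ 2 * ‖fourierCoeff h k‖ ^ 2) :
    HasSum (fun k : ℤ => ((if k = 0 then 1 else 0) + (k : ℝ) ^ 2) * ‖fourierCoeff h k‖ ^ 2)
      (kappa h ^ 2) := by
  have h0 : 0 ≤ ∑' k : ℤ, (k : ℝ) ^ 2 * ‖fourierCoeff h k‖ ^ 2 :=
    tsum_nonneg fun _ => by positivity
  rw [kappa, Real.sq_sqrt (by positivity)]
  have h1 := (hasSum_ite_eq (0 : ℤ) (‖fourierCoeff h 0‖ ^ 2)).add hs.hasSum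
  refine h1.congr_fun fun k => ?_
  by_cases hk : k = 0
  · simp [hk]
  · simp [hk]

/-- By Parseval it suffices to compare the coefficients one by one; the squared Lipschitz constants
weighted by |ĥ(k)|² sum to κ². -/
theorem lintegral_phaseFilter_sub_sq_le {h : Phase → ℂ}
    (hh : MemLp h 2 AddCircle.haarAddCircle)
    (hs : Summable fun k : ℤ => (k : ℝ) ^ 2 * ‖fourierCoeff h k‖ ^ 2) (z z' : ℂ) :
    ∫⁻ a, ‖phaseFilter h z a - phaseFilter h z' a‖ₑ ^ 2 ∂AddCircle.haarAddCircle ≤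
      ENNReal.ofReal (kappa h ^ 2) * ‖z - z'‖ₑ ^ 2 := by
  have hz := memLp_phaseFilter hh z
  have hz' := memLp_phaseFilter hh z'
  have h1 := tsum_enorm_fourierCoeff_sq (hz.sub hz')
  simp only [Pi.sub_apply] at h1
  rw [← h1, ← (kappa_sq_eq hs).tsum_eq, ENNReal.ofReal_tsum_of_nonneg (fun _ => by positivity)
    (kappa_sq_eq hs).summable, ← ENNReal.tsum_mul_right]
  refine ENNReal.tsum_le_tsum fun k => ?_
  have h2 : fourierCoeff (phaseFilter h z - phaseFilter h z') k =
      fourierCoeff (phaseFilter h z) k - fourierCoeff (phaseFilter h z') k := by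
    simp only [fourierCoeff, Pi.sub_apply, smul_sub]
    have hint : ∀ w : ℂ, Integrable (fun t => (fourier (-k) t : ℂ) • phaseFilter h w t)
        AddCircle.haarAddCircle := fun w =>
      ((memLp_phaseFilter hh w).integrable one_le_two).bdd_mul (c := 1)
        (by fun_prop) (by simp [fourier_apply, Circle.norm_coe])
    exact integral_sub (hint z) (hint z')
  rw [h2, fourierCoeff_phaseFilter, fourierCoeff_phaseFilter, ← sub_mul, enorm_mul,
    ← ofReal_norm, ← ofReal_norm, ← ofReal_norm, ← ENNReal.ofReal_mul (norm_nonneg _),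
    ← ENNReal.ofReal_pow (by positivity), ← ENNReal.ofReal_pow (by positivity),
    ← ENNReal.ofReal_mul (by positivity)]
  refine ENNReal.ofReal_le_ofReal ?_
  have h3 := norm_phase_power_sub_sq_le (-k) z z'
  rw [mul_pow]
  have h4 := mul_le_mul_of_nonneg_right h3 (sq_nonneg ‖fourierCoeff h k‖)
  refine h4.trans_eq ?_
  simp only [neg_eq_zero, Int.cast_neg]
  ring

variable {α Λ : Type*} [MeasurableSpace α] [Countable Λ] [MeasurableSpace Λ]
  [MeasurableSingletonClass Λ] {μ : Measure α} {h : Phase → ℂ} {F F' : Λ → α → ℂ}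

instance : SigmaFinite (phaseMeasure Λ) := by
  unfold phaseMeasure
  infer_instance

/-- The phase filter applied to a family of functions. -/
noncomputable def phaseFamily (h : Phase → ℂ) (F : Λ → α → ℂ) (z : α × (Λ × Phase)) : ℂ :=
  phaseFilter h (F z.2.1 z.1) z.2.2

theorem measurable_family (hF : ∀ l, Measurable (F l)) :
    Measurable fun z : α × (Λ × Phase) => F z.2.1 z.1 := by
  have h1 : Measurable fun z : Λ × α => F z.1 z.2 := measurable_from_prod_countable_right hF
  exact h1.comp (by fun_prop : Measurable fun z : α × (Λ × Phase) => (z.2.1, z.1))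

theorem aestronglyMeasurable_phaseFamily (hh : AEStronglyMeasurable h AddCircle.haarAddCircle)
    (hF : ∀ l, Measurable (F l)) :
    AEStronglyMeasurable (phaseFamily h F) (μ.prod (phaseMeasure Λ)) := by
  have hm := measurable_family hF
  have hs : Measurable fun z : α × (Λ × Phase) =>
      z.2.2 - ((Complex.arg (F z.2.1 z.1) : ℝ) : Phase) :=
    (measurable_snd.comp measurable_snd).sub
      (AddCircle.measurable_mk'.comp (Complex.measurable_arg.comp hm))
  -- As `h` is only measurable up to a null set, the substitution must pull null sets back to null
  -- sets. It does, because for fixed u and λ it is a rotation in α.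
  have hq : Measure.QuasiMeasurePreserving (fun z : α × (Λ × Phase) =>
      z.2.2 - ((Complex.arg (F z.2.1 z.1) : ℝ) : Phase)) (μ.prod (phaseMeasure Λ))
      AddCircle.haarAddCircle := by
    refine ⟨hs, Measure.AbsolutelyContinuous.mk fun s hsm h0 => ?_⟩
    rw [Measure.map_apply hs hsm, Measure.measure_prod_null (hs hsm)]
    refine Filter.Eventually.of_forall fun u => ?_
    rw [phaseMeasure, Pi.zero_apply,
      Measure.measure_prod_null (measurable_prodMk_left (hs hsm))]
    refine Filter.Eventually.of_forall fun l => ?_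
    change AddCircle.haarAddCircle
      ((fun a : Phase => a - ((Complex.arg (F l u) : ℝ) : Phase)) ⁻¹' s) = 0
    rw [(measurePreserving_phase_sub _).measure_preimage hsm.nullMeasurableSet, h0]
  exact (Complex.measurable_ofReal.comp hm.norm).aestronglyMeasurable.mul
    (hh.comp_quasiMeasurePreserving hq)

theorem lintegral_prod_phaseMeasure {G : α × (Λ × Phase) → ℝ≥0∞}
    (hG : AEMeasurable G (μ.prod (phaseMeasure Λ))) :
    ∫⁻ z, G z ∂(μ.prod (phaseMeasure Λ)) =
      ∫⁻ u, ∑' l, ∫⁻ a, G (u, (l, a)) ∂AddCircle.haarAddCircle ∂μ := by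
  rw [lintegral_prod _ hG]
  refine lintegral_congr_ae ?_
  filter_upwards [hG.aestronglyMeasurable.prodMk_left] with u hu
  rw [phaseMeasure, lintegral_prod _ hu.aemeasurable, lintegral_count]

theorem lintegral_phaseFamily_sq (hh : MemLp h 2 AddCircle.haarAddCircle)
    (hF : ∀ l, Measurable (F l)) :
    ∫⁻ z, ‖phaseFamily h F z‖ₑ ^ 2 ∂(μ.prod (phaseMeasure Λ)) =
      ENNReal.ofReal (normSqFilter h) * ∑' l, ∫⁻ u, ‖F l u‖ₑ ^ 2 ∂μ := by
  rw [lintegral_prod_phaseMeasure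
    ((aestronglyMeasurable_phaseFamily hh.1 hF).enorm.pow_const 2)]
  simp only [phaseFamily, lintegral_phaseFilter_sq h hh]
  rw [lintegral_tsum (fun l => (((hF l).enorm.pow_const 2).mul_const _).aemeasurable),
    ← ENNReal.tsum_mul_left]
  refine tsum_congr fun l => ?_
  rw [lintegral_mul_const _ ((hF l).enorm.pow_const 2), mul_comm]

theorem lintegral_phaseFamily_sub_sq_le (hh : MemLp h 2 AddCircle.haarAddCircle)
    (hs : Summable fun k : ℤ => (k : ℝ) ^ 2 * ‖fourierCoeff h k‖ ^ 2)
    (hF : ∀ l, Measurable (F l)) (hF' : ∀ l, Measurable (F' l)) :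
    ∫⁻ z, ‖phaseFamily h F z - phaseFamily h F' z‖ₑ ^ 2 ∂(μ.prod (phaseMeasure Λ)) ≤
      ENNReal.ofReal (kappa h ^ 2) * ∑' l, ∫⁻ u, ‖F l u - F' l u‖ₑ ^ 2 ∂μ := by
  have hm : AEMeasurable (fun z => ‖phaseFamily h F z - phaseFamily h F' z‖ₑ ^ 2)
      (μ.prod (phaseMeasure Λ)) := ((aestronglyMeasurable_phaseFamily hh.1 hF).sub
    (aestronglyMeasurable_phaseFamily hh.1 hF')).enorm.pow_const 2
  rw [lintegral_prod_phaseMeasure hm]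
  have hd : ∀ l, Measurable fun u => ‖F l u - F' l u‖ₑ ^ 2 :=
    fun l => ((hF l).sub (hF' l)).enorm.pow_const 2
  calc _ ≤ ∫⁻ u, ∑' l, ENNReal.ofReal (kappa h ^ 2) * ‖F l u - F' l u‖ₑ ^ 2 ∂μ :=
        lintegral_mono fun u => ENNReal.tsum_le_tsum fun l =>
          lintegral_phaseFilter_sub_sq_le hh hs _ _
    _ = _ := by
      rw [lintegral_tsum (fun l => ((hd l).const_mul _).aemeasurable),
        ← ENNReal.tsum_mul_left]
      refine tsum_congr fun l => ?_
      rw [lintegral_const_mul _ (hd l)]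

end PhaseFilter

/-! ### Convolution on a group along a map from the domain of the filter. -/

section ConvAlong

variable {V G : Type*} [MeasurableSpace V] [MeasurableSpace G] [AddCommGroup G]
  {vol : Measure V} {μ : Measure G} {π : V → G} {X Y : G → ℂ} {ψ φ : V → ℂ}

/-- The convolution `∫ X(t - π(v)) ψ(v) dv` of a function on `G` with a function on `V`, where
`π` maps `V` to `G`. -/
noncomputable def convAlong (vol : Measure V) (π : V → G) (X : G → ℂ) (ψ : V → ℂ) (t : G) : ℂ :=
  ∫ v, X (t - π v) * ψ v ∂vol

theorem convAlong_congr_right {V G : Type*} [MeasurableSpace V] [AddCommGroup G]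
    {vol : Measure V} {π : V → G} {X : G → ℂ} {ψ φ : V → ℂ} (h : ψ =ᵐ[vol] φ) :
    convAlong vol π X ψ = convAlong vol π X φ := by
  ext t
  refine integral_congr_ae ?_
  filter_upwards [h] with v hv
  rw [hv]

theorem measurable_convAlong [SFinite vol] [MeasurableSub₂ G] (hπ : Measurable π)
    (hX : Measurable X) (hψ : AEStronglyMeasurable ψ vol) : Measurable (convAlong vol π X ψ) := by
  rw [convAlong_congr_right hψ.ae_eq_mk]
  have h1 : Measurable fun z : G × V => X (z.1 - π z.2) * hψ.mk ψ z.2 :=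
    (hX.comp (measurable_fst.sub (hπ.comp measurable_snd))).mul
      (hψ.stronglyMeasurable_mk.measurable.comp measurable_snd)
  exact h1.stronglyMeasurable.integral_prod_right'.measurable

/-- Young's inequality for L² and L¹: write |ψ| as the square of |ψ|^(1/2), apply Cauchy–Schwarz in
v, and use translation invariance in t. Absolute values stay inside, so this also gives the
almost-everywhere convergence of the convolution. -/
theorem lintegral_convAlong_enorm_sq_le [SFinite vol] [SFinite μ] [MeasurableAdd G]
    [MeasurableSub₂ G] [μ.IsAddRightInvariant] (hπ : Measurable π) (hX : Measurable X)
    (hψ : AEStronglyMeasurable ψ vol) :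
    ∫⁻ t, (∫⁻ v, ‖X (t - π v) * ψ v‖ₑ ∂vol) ^ 2 ∂μ ≤
      (∫⁻ v, ‖ψ v‖ₑ ∂vol) ^ 2 * ∫⁻ t, ‖X t‖ₑ ^ 2 ∂μ := by
  have hXm : Measurable fun z : G × V => ‖X (z.1 - π z.2)‖ₑ :=
    (hX.comp (measurable_fst.sub (hπ.comp measurable_snd))).enorm
  have hm : AEMeasurable (fun z : G × V => ‖X (z.1 - π z.2)‖ₑ ^ 2 * ‖ψ z.2‖ₑ) (μ.prod vol) :=
    (hXm.pow_const 2).aemeasurable.mul hψ.comp_snd.enorm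
  calc ∫⁻ t, (∫⁻ v, ‖X (t - π v) * ψ v‖ₑ ∂vol) ^ 2 ∂μ
      ≤ ∫⁻ t, (∫⁻ v, ‖ψ v‖ₑ ∂vol) * ∫⁻ v, ‖X (t - π v)‖ₑ ^ 2 * ‖ψ v‖ₑ ∂vol ∂μ := by
        refine lintegral_mono fun t => ?_
        have h1 : ∀ a : ℝ≥0∞, a = a ^ (1 / 2 : ℝ) * a ^ (1 / 2 : ℝ) := fun a => by
          rw [← ENNReal.rpow_add_of_nonneg _ _ (by norm_num) (by norm_num)]
          norm_num
        have h2 : ∀ a : ℝ≥0∞, (a ^ (1 / 2 : ℝ)) ^ 2 = a := fun a => by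
          rw [pow_two, ← h1]
        have h3 := lintegral_mul_sq_le (μ := vol) (f := fun v => ‖ψ v‖ₑ ^ (1 / 2 : ℝ))
          (g := fun v => ‖X (t - π v)‖ₑ * ‖ψ v‖ₑ ^ (1 / 2 : ℝ)) (hψ.enorm.pow_const _)
          ((hXm.comp measurable_prodMk_left).aemeasurable.mul (hψ.enorm.pow_const _))
        simp only [mul_pow, h2] at h3
        refine le_trans (le_of_eq ?_) h3
        congr 1
        refine lintegral_congr fun v => ?_
        rw [enorm_mul]
        nth_rewrite 1 [h1 ‖ψ v‖ₑ]
        ring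
    _ = (∫⁻ v, ‖ψ v‖ₑ ∂vol) * ∫⁻ t, ∫⁻ v, ‖X (t - π v)‖ₑ ^ 2 * ‖ψ v‖ₑ ∂vol ∂μ :=
        lintegral_const_mul'' _ hm.lintegral_prod_right'
    _ = (∫⁻ v, ‖ψ v‖ₑ ∂vol) * ∫⁻ v, (∫⁻ t, ‖X t‖ₑ ^ 2 ∂μ) * ‖ψ v‖ₑ ∂vol := by
        rw [lintegral_lintegral_swap hm]
        congr 1
        refine lintegral_congr fun v => ?_
        have hv : Measurable fun t => ‖X (t - π v)‖ₑ := hXm.comp measurable_prodMk_right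
        rw [lintegral_mul_const _ (hv.pow_const 2),
          lintegral_sub_right_eq_self (fun t => ‖X t‖ₑ ^ 2)]
    _ = _ := by
        rw [lintegral_const_mul'' _ hψ.enorm]
        ring

theorem ae_integrable_convAlong [SFinite vol] [SFinite μ] [MeasurableAdd G]
    [MeasurableSub₂ G] [μ.IsAddRightInvariant] (hπ : Measurable π) (hX : Measurable X)
    (hX2 : MemLp X 2 μ) (hψ : Integrable ψ vol) :
    ∀ᵐ t ∂μ, Integrable (fun v => X (t - π v) * ψ v) vol := by
  have hm : AEStronglyMeasurable (fun z : G × V => X (z.1 - π z.2) * ψ z.2) (μ.prod vol) :=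
    (hX.comp (measurable_fst.sub (hπ.comp measurable_snd))).aestronglyMeasurable.mul
      hψ.1.comp_snd
  have h1 := (lintegral_convAlong_enorm_sq_le (μ := μ) hπ hX hψ.1).trans_lt
    (ENNReal.mul_lt_top (ENNReal.pow_lt_top hψ.2) (lintegral_lt_top_of_memLp_two hX2))
  filter_upwards [ae_lt_top' (hm.enorm.lintegral_prod_right'.pow_const 2) h1.ne,
    hm.prodMk_left] with t ht hmt
  refine ⟨hmt, ?_⟩
  by_contra hc
  rw [HasFiniteIntegral, not_lt, top_le_iff] at hc
  simp only [hc, ENNReal.top_pow two_ne_zero, lt_self_iff_false] at ht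

theorem eLpNorm_convAlong_le [SFinite vol] [SFinite μ] [MeasurableAdd G]
    [MeasurableSub₂ G] [μ.IsAddRightInvariant] (hπ : Measurable π) (hX : Measurable X)
    (hψ : AEStronglyMeasurable ψ vol) :
    eLpNorm (convAlong vol π X ψ) 2 μ ≤ (∫⁻ v, ‖ψ v‖ₑ ∂vol) * eLpNorm X 2 μ := by
  rw [← ENNReal.pow_le_pow_left_iff two_ne_zero, mul_pow, eLpNorm_two_sq, eLpNorm_two_sq]
  refine le_trans (lintegral_mono fun t => ?_) (lintegral_convAlong_enorm_sq_le hπ hX hψ)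
  exact pow_le_pow_left' (enorm_integral_le_lintegral_enorm _) 2

theorem memLp_convAlong [SFinite vol] [SFinite μ] [MeasurableAdd G]
    [MeasurableSub₂ G] [μ.IsAddRightInvariant] (hπ : Measurable π) (hX : Measurable X)
    (hX2 : MemLp X 2 μ) (hψ : Integrable ψ vol) : MemLp (convAlong vol π X ψ) 2 μ :=
  ⟨(measurable_convAlong hπ hX hψ.1).aestronglyMeasurable,
    (eLpNorm_convAlong_le hπ hX hψ.1).trans_lt (ENNReal.mul_lt_top hψ.2 hX2.2)⟩

theorem convAlong_sub_left [SFinite vol] [SFinite μ] [MeasurableAdd G]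
    [MeasurableSub₂ G] [μ.IsAddRightInvariant] (hπ : Measurable π) (hX : Measurable X)
    (hX2 : MemLp X 2 μ) (hY : Measurable Y) (hY2 : MemLp Y 2 μ) (hψ : Integrable ψ vol) :
    convAlong vol π (X - Y) ψ =ᵐ[μ] convAlong vol π X ψ - convAlong vol π Y ψ := by
  filter_upwards [ae_integrable_convAlong hπ hX hX2 hψ,
    ae_integrable_convAlong hπ hY hY2 hψ] with t h1 h2
  simp only [convAlong, Pi.sub_apply, sub_mul]
  exact integral_sub h1 h2

theorem convAlong_sub_right [SFinite vol] [SFinite μ] [MeasurableAdd G]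
    [MeasurableSub₂ G] [μ.IsAddRightInvariant] (hπ : Measurable π) (hX : Measurable X)
    (hX2 : MemLp X 2 μ) (hψ : Integrable ψ vol) (hφ : Integrable φ vol) :
    convAlong vol π X (ψ - φ) =ᵐ[μ] convAlong vol π X ψ - convAlong vol π X φ := by
  filter_upwards [ae_integrable_convAlong hπ hX hX2 hψ,
    ae_integrable_convAlong hπ hX hX2 hφ] with t h1 h2
  simp only [convAlong, Pi.sub_apply, mul_sub]
  exact integral_sub h1 h2

theorem eLpNorm_convAlong_le_add [SFinite vol] [SFinite μ] [MeasurableAdd G]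
    [MeasurableSub₂ G] [μ.IsAddRightInvariant] (hπ : Measurable π) (hX : Measurable X)
    (hX2 : MemLp X 2 μ) (hY : Measurable Y) (hY2 : MemLp Y 2 μ) (hψ : Integrable ψ vol)
    (hφ : Integrable φ vol) :
    eLpNorm (convAlong vol π X ψ) 2 μ ≤ eLpNorm (convAlong vol π Y φ) 2 μ +
      ((∫⁻ v, ‖ψ v‖ₑ ∂vol) * eLpNorm (X - Y) 2 μ +
        (∫⁻ v, ‖(ψ - φ) v‖ₑ ∂vol) * eLpNorm Y 2 μ) := by
  -- Bilinear telescoping: first X is changed to Y, then ψ to φ.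
  have h1 : convAlong vol π X ψ =ᵐ[μ] convAlong vol π Y φ +
      (convAlong vol π (X - Y) ψ + convAlong vol π Y (ψ - φ)) := by
    filter_upwards [convAlong_sub_left hπ hX hX2 hY hY2 hψ,
      convAlong_sub_right hπ hY hY2 hψ hφ] with t h2 h3
    simp only [Pi.add_apply, h2, h3, Pi.sub_apply]
    ring
  rw [eLpNorm_congr_ae h1]
  have m1 := (measurable_convAlong hπ hY hφ.1).aestronglyMeasurable (μ := μ)
  have m2 := (measurable_convAlong hπ (hX.sub hY) hψ.1).aestronglyMeasurable (μ := μ)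
  have m3 := (measurable_convAlong hπ hY (hψ.sub hφ).1).aestronglyMeasurable (μ := μ)
  refine (eLpNorm_add_le m1 (m2.add m3) one_le_two).trans ?_
  gcongr
  refine (eLpNorm_add_le m2 m3 one_le_two).trans ?_
  exact add_le_add (eLpNorm_convAlong_le hπ (hX.sub hY) hψ.1)
    (eLpNorm_convAlong_le hπ hY (hψ.sub hφ).1)

end ConvAlong

/-! ### Plancherel for the convolution of L² with L¹ on ℝ^d. -/

section Plancherel

open FourierTransform SchwartzMap

variable {d : ℕ}

/-- The bound, used with p and q in both orders, squeezes N p to N q. It is what the norm of a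
bounded bilinear map satisfies. -/
theorem continuous_of_bilinear_bound {A B : Type*} [SeminormedAddCommGroup A]
    [SeminormedAddCommGroup B] {N : A × B → ℝ}
    (hN : ∀ p q, N p ≤ N q + (‖p.2‖ * ‖p.1 - q.1‖ + ‖p.2 - q.2‖ * ‖q.1‖)) : Continuous N := by
  rw [continuous_iff_continuousAt]
  intro q
  have h1 : Filter.Tendsto (fun p : A × B => N q + (‖p.2‖ * ‖p.1 - q.1‖ + ‖p.2 - q.2‖ * ‖q.1‖))
      (nhds q) (nhds (N q)) := by
    have : Continuous fun p : A × B =>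
      N q + (‖p.2‖ * ‖p.1 - q.1‖ + ‖p.2 - q.2‖ * ‖q.1‖) := by fun_prop
    simpa using this.tendsto q
  have h2 : Filter.Tendsto (fun p : A × B => N q - (‖q.2‖ * ‖q.1 - p.1‖ + ‖q.2 - p.2‖ * ‖p.1‖))
      (nhds q) (nhds (N q)) := by
    have : Continuous fun p : A × B =>
      N q - (‖q.2‖ * ‖q.1 - p.1‖ + ‖q.2 - p.2‖ * ‖p.1‖) := by fun_prop
    simpa using this.tendsto q
  exact tendsto_of_tendsto_of_tendsto_of_le_of_le h2 h1
    (fun p => by have := hN q p; simp only; linarith) (fun p => hN p q)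

theorem enorm_fourier_le (ψ : Space d → ℂ) (ξ : Space d) :
    ‖𝓕 ψ ξ‖ₑ ≤ ∫⁻ v, ‖ψ v‖ₑ := by
  rw [Real.fourier_eq]
  refine (enorm_integral_le_lintegral_enorm _).trans_eq ?_
  refine lintegral_congr fun v => ?_
  exact enorm_eq_iff_norm_eq.2 (Circle.norm_smul _ _)

theorem fourier_sub_fun {ψ φ : Space d → ℂ} (hψ : Integrable ψ) (hφ : Integrable φ) :
    𝓕 (ψ - φ) = 𝓕 ψ - 𝓕 φ := by
  ext ξ
  simp only [Real.fourier_eq, Pi.sub_apply, smul_sub]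
  exact integral_sub ((Real.fourierIntegral_convergent_iff ξ).2 hψ)
    ((Real.fourierIntegral_convergent_iff ξ).2 hφ)

theorem fourier_congr_ae {ψ φ : Space d → ℂ} (h : ψ =ᵐ[volume] φ) : 𝓕 ψ = 𝓕 φ := by
  ext ξ
  simp only [Real.fourier_eq]
  refine integral_congr_ae ?_
  filter_upwards [h] with v hv
  rw [hv]

theorem continuous_fourier {ψ : Space d → ℂ} (hψ : Integrable ψ) : Continuous (𝓕 ψ) :=
  VectorFourier.fourierIntegral_continuous Real.continuous_fourierChar continuous_inner hψ

theorem eLpNorm_mul_fourier_le {f : Space d → ℂ} (hf : AEStronglyMeasurable f)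
    (ψ : Space d → ℂ) :
    eLpNorm (fun ξ => f ξ * 𝓕 ψ ξ) 2 volume ≤ (∫⁻ v, ‖ψ v‖ₑ) * eLpNorm f 2 volume := by
  rw [← ENNReal.pow_le_pow_left_iff two_ne_zero, mul_pow, eLpNorm_two_sq, eLpNorm_two_sq,
    ← lintegral_const_mul'' _ (hf.enorm.pow_const 2)]
  refine lintegral_mono fun ξ => ?_
  rw [enorm_mul, mul_pow, mul_comm]
  gcongr
  exact enorm_fourier_le ψ ξ

theorem eLpNorm_mul_fourier_le_add {f g : Space d → ℂ} (hf : AEStronglyMeasurable f)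
    (hg : AEStronglyMeasurable g) {ψ φ : Space d → ℂ} (hψ : Integrable ψ) (hφ : Integrable φ) :
    eLpNorm (fun ξ => f ξ * 𝓕 ψ ξ) 2 volume ≤ eLpNorm (fun ξ => g ξ * 𝓕 φ ξ) 2 volume +
      ((∫⁻ v, ‖ψ v‖ₑ) * eLpNorm (f - g) 2 volume +
        (∫⁻ v, ‖(ψ - φ) v‖ₑ) * eLpNorm g 2 volume) := by
  have h1 : (fun ξ => f ξ * 𝓕 ψ ξ) = (fun ξ => g ξ * 𝓕 φ ξ) +
      ((fun ξ => (f - g) ξ * 𝓕 ψ ξ) + fun ξ => g ξ * 𝓕 (ψ - φ) ξ) := by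
    ext ξ
    simp only [fourier_sub_fun hψ hφ, Pi.add_apply, Pi.sub_apply]
    ring
  have hc : ∀ {χ : Space d → ℂ}, Integrable χ → AEStronglyMeasurable (𝓕 χ) volume :=
    fun hχ => (continuous_fourier hχ).aestronglyMeasurable
  have m1 : AEStronglyMeasurable (fun ξ => g ξ * 𝓕 φ ξ) volume := hg.mul (hc hφ)
  have m2 : AEStronglyMeasurable (fun ξ => (f - g) ξ * 𝓕 ψ ξ) volume := (hf.sub hg).mul (hc hψ)
  have m3 : AEStronglyMeasurable (fun ξ => g ξ * 𝓕 (ψ - φ) ξ) volume :=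
    hg.mul (hc (hψ.sub hφ))
  rw [h1]
  refine (eLpNorm_add_le m1 (m2.add m3) one_le_two).trans ?_
  gcongr
  refine (eLpNorm_add_le m2 m3 one_le_two).trans ?_
  exact add_le_add (eLpNorm_mul_fourier_le (hf.sub hg) ψ) (eLpNorm_mul_fourier_le hg (ψ - φ))

theorem convAlong_id_eq_convolution (X ψ : Space d → ℂ) :
    convAlong volume id X ψ = convolution X ψ (ContinuousLinearMap.mul ℂ ℂ) volume := by
  ext t
  rw [convolution_eq_swap]
  rfl

theorem eLpNorm_convAlong_schwartz (f g : 𝓢(Space d, ℂ)) :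
    eLpNorm (convAlong volume id f g) 2 volume =
      eLpNorm (fun ξ => 𝓕 (f : Space d → ℂ) ξ * 𝓕 (g : Space d → ℂ) ξ) 2 volume := by
  set c := SchwartzMap.convolution (ContinuousLinearMap.mul ℂ ℂ) f g with hc
  have h1 : convAlong volume id f g = c := by
    rw [convAlong_id_eq_convolution]
    ext t
    rw [hc, SchwartzMap.convolution_apply]
  have h2 : (fun ξ => 𝓕 (f : Space d → ℂ) ξ * 𝓕 (g : Space d → ℂ) ξ) = 𝓕 c := by
    ext ξ
    rw [hc, SchwartzMap.fourier_convolution_apply,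
      Real.fourier_mul_convolution_eq f.integrable g.integrable]
  have h3 := Lp.norm_fourier_eq (c.toLp 2)
  rw [SchwartzMap.toLp_fourier_eq, SchwartzMap.norm_toLp, SchwartzMap.norm_toLp] at h3
  have h4 : eLpNorm (𝓕 c : 𝓢(Space d, ℂ)) 2 volume ≠ ⊤ :=
    (SchwartzMap.memLp (𝓕 c : 𝓢(Space d, ℂ)) 2 volume).2.ne
  have h5 : eLpNorm c 2 volume ≠ ⊤ := (SchwartzMap.memLp c 2 volume).2.ne
  rw [h1, h2]
  exact ((ENNReal.toReal_eq_toReal_iff' h4 h5).1 h3).symm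

theorem toReal_le_of_bilinear_bound (f g : Lp ℂ 2 (volume : Measure (Space d)))
    (ψ φ : Lp ℂ 1 (volume : Measure (Space d))) {a b : ℝ≥0∞} (hb : b ≠ ⊤)
    (hab : a ≤ b + ((∫⁻ v, ‖ψ v‖ₑ) * eLpNorm ((f : Space d → ℂ) - (g : Space d → ℂ)) 2 volume +
      (∫⁻ v, ‖((ψ : Space d → ℂ) - (φ : Space d → ℂ)) v‖ₑ) * eLpNorm g 2 volume)) :
    a.toReal ≤ b.toReal + (‖ψ‖ * ‖f - g‖ + ‖ψ - φ‖ * ‖g‖) := by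
  rw [← eLpNorm_one_eq_lintegral_enorm, ← eLpNorm_one_eq_lintegral_enorm,
    ← eLpNorm_congr_ae (Lp.coeFn_sub f g), ← eLpNorm_congr_ae (Lp.coeFn_sub ψ φ)] at hab
  rw [Lp.norm_def, Lp.norm_def, Lp.norm_def, Lp.norm_def, ← ENNReal.toReal_mul,
    ← ENNReal.toReal_mul]
  have f1 := ENNReal.mul_ne_top (Lp.eLpNorm_ne_top ψ) (Lp.eLpNorm_ne_top (f - g))
  have f2 := ENNReal.mul_ne_top (Lp.eLpNorm_ne_top (ψ - φ)) (Lp.eLpNorm_ne_top g)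
  rw [← ENNReal.toReal_add f1 f2, ← ENNReal.toReal_add hb (ENNReal.add_ne_top.2 ⟨f1, f2⟩)]
  exact ENNReal.toReal_mono (ENNReal.add_ne_top.2 ⟨hb, ENNReal.add_ne_top.2 ⟨f1, f2⟩⟩) hab

theorem eLpNorm_convAlong_ne_top (g : Lp ℂ 2 (volume : Measure (Space d))) {χ : Space d → ℂ}
    (hχ : Integrable χ) : eLpNorm (convAlong volume id g χ) 2 volume ≠ ⊤ :=
  (memLp_convAlong measurable_id (Lp.stronglyMeasurable g).measurable (Lp.memLp g) hχ).2.ne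

theorem eLpNorm_mul_fourier_ne_top (g : Lp ℂ 2 (volume : Measure (Space d))) {χ : Space d → ℂ}
    (hχ : Integrable χ) : eLpNorm (fun ξ => g ξ * 𝓕 χ ξ) 2 volume ≠ ⊤ :=
  ((eLpNorm_mul_fourier_le (Lp.aestronglyMeasurable g) χ).trans_lt
    (ENNReal.mul_lt_top hχ.2 (Lp.memLp g).2)).ne

theorem continuous_eLpNorm_convAlong :
    Continuous fun p : Lp ℂ 2 (volume : Measure (Space d)) ×
      Lp ℂ 1 (volume : Measure (Space d)) =>
      (eLpNorm (convAlong volume id p.1 p.2) 2 volume).toReal :=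
  continuous_of_bilinear_bound fun p q => toReal_le_of_bilinear_bound p.1 q.1 p.2 q.2
    (eLpNorm_convAlong_ne_top _ (L1.integrable_coeFn _))
    (eLpNorm_convAlong_le_add measurable_id (Lp.stronglyMeasurable _).measurable (Lp.memLp _)
      (Lp.stronglyMeasurable _).measurable (Lp.memLp _) (L1.integrable_coeFn _)
      (L1.integrable_coeFn _))

theorem continuous_eLpNorm_mul_fourier :
    Continuous fun p : Lp ℂ 2 (volume : Measure (Space d)) ×
      Lp ℂ 1 (volume : Measure (Space d)) =>
      (eLpNorm (fun ξ => p.1 ξ * 𝓕 (p.2 : Space d → ℂ) ξ) 2 volume).toReal :=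
  continuous_of_bilinear_bound fun p q => toReal_le_of_bilinear_bound p.1 q.1 p.2 q.2
    (eLpNorm_mul_fourier_ne_top _ (L1.integrable_coeFn _))
    (eLpNorm_mul_fourier_le_add (Lp.aestronglyMeasurable _) (Lp.aestronglyMeasurable _)
      (L1.integrable_coeFn _) (L1.integrable_coeFn _))

theorem eLpNorm_convAlong_toLp (g χ : 𝓢(Space d, ℂ)) :
    eLpNorm (convAlong volume id (g.toLp 2 volume) (χ.toLp 1 volume)) 2 volume =
      eLpNorm (fun ξ => (𝓕 (g.toLp 2 volume) : Lp ℂ 2 (volume : Measure (Space d))) ξ *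
        𝓕 (χ.toLp 1 volume : Space d → ℂ) ξ) 2 volume := by
  have e1 : (g.toLp 2 volume : Space d → ℂ) =ᵐ[volume] g := SchwartzMap.coeFn_toLp g 2 volume
  have e2 : (χ.toLp 1 volume : Space d → ℂ) =ᵐ[volume] χ := SchwartzMap.coeFn_toLp χ 1 volume
  have h1 : convAlong volume id (g.toLp 2 volume) (χ.toLp 1 volume : Space d → ℂ) =
      convAlong volume id g χ := by
    rw [convAlong_id_eq_convolution, convAlong_id_eq_convolution]
    exact convolution_congr _ e1 e2
  have h2 : ((𝓕 (g.toLp 2 volume) : Lp ℂ 2 (volume : Measure (Space d))) : Space d → ℂ) =ᵐ[volume]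
      𝓕 (g : Space d → ℂ) := by
    rw [SchwartzMap.toLp_fourier_eq]
    exact SchwartzMap.coeFn_toLp (𝓕 g : 𝓢(Space d, ℂ)) 2 volume
  rw [h1, eLpNorm_convAlong_schwartz, fourier_congr_ae e2]
  refine eLpNorm_congr_ae ?_
  filter_upwards [h2] with ξ hξ
  rw [hξ]

/-- Convolving with an integrable function is multiplication by its Fourier transform. -/
theorem eLpNorm_convAlong_eq (f : Lp ℂ 2 (volume : Measure (Space d))) {ψ : Space d → ℂ}
    (hψ : Integrable ψ) :
    eLpNorm (convAlong volume id f ψ) 2 volume =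
      eLpNorm (fun ξ => (𝓕 f : Lp ℂ 2 (volume : Measure (Space d))) ξ * 𝓕 ψ ξ) 2 volume := by
  have hF : Continuous fun g : Lp ℂ 2 (volume : Measure (Space d)) =>
      (𝓕 g : Lp ℂ 2 (volume : Measure (Space d))) :=
    (Lp.fourierTransformₗᵢ (Space d) ℂ).continuous
  have hF' : Continuous fun p : Lp ℂ 2 (volume : Measure (Space d)) ×
      Lp ℂ 1 (volume : Measure (Space d)) =>
      ((𝓕 p.1 : Lp ℂ 2 (volume : Measure (Space d))), p.2) :=
    (hF.comp continuous_fst).prodMk continuous_snd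
  have hN := Continuous.comp continuous_eLpNorm_mul_fourier hF'
  have hd1 : DenseRange (SchwartzMap.toLpCLM ℝ (E := Space d) ℂ 2 volume) :=
    SchwartzMap.denseRange_toLpCLM ENNReal.ofNat_ne_top
  have hd2 : DenseRange (SchwartzMap.toLpCLM ℝ (E := Space d) ℂ 1 volume) :=
    SchwartzMap.denseRange_toLpCLM ENNReal.one_ne_top
  -- Both norms are continuous on L² × L¹ and agree on the dense set of Schwartz pairs. Both are
  -- finite, so passing to real values loses nothing.
  have key := congrFun ((hd1.prodMap hd2).equalizer continuous_eLpNorm_convAlong hN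
    (funext fun p => congrArg ENNReal.toReal (eLpNorm_convAlong_toLp p.1 p.2))) (f, hψ.toL1 ψ)
  simp only [Function.comp_apply] at key
  rw [ENNReal.toReal_eq_toReal_iff'
      (eLpNorm_convAlong_ne_top _ (L1.integrable_coeFn _))
      (eLpNorm_mul_fourier_ne_top _ (L1.integrable_coeFn _)),
      convAlong_congr_right hψ.coeFn_toL1, fourier_congr_ae hψ.coeFn_toL1] at key
  exact key

end Plancherel

/-! ### Littlewood–Paley energy bounds on ℝ^d. -/

section Energy

open FourierTransform

variable {d : ℕ}

theorem fourier_eq_freqResponse (ψ : Space d → ℂ) (ξ : Space d) :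
    𝓕 ψ ξ = freqResponse ψ ((2 * Real.pi) • ξ) := by
  rw [Real.fourier_eq, freqResponse]
  refine integral_congr_ae (Filter.Eventually.of_forall fun v => ?_)
  simp only [Circle.smul_def, Real.fourierChar_apply, smul_eq_mul, real_inner_smul_left,
    real_inner_comm v ξ]
  congr 2
  push_cast
  ring

theorem freqResponse_eq_fourier (ψ : Space d → ℂ) (ω : Space d) :
    freqResponse ψ ω = 𝓕 ψ ((2 * Real.pi)⁻¹ • ω) := by
  rw [fourier_eq_freqResponse, smul_inv_smul₀ Real.two_pi_pos.ne']

theorem continuous_freqResponse {ψ : Space d → ℂ} (hψ : Integrable ψ) :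
    Continuous (freqResponse ψ) := by
  have h : freqResponse ψ = fun ω => 𝓕 ψ ((2 * Real.pi)⁻¹ • ω) :=
    funext (freqResponse_eq_fourier ψ)
  rw [h]
  exact (continuous_fourier hψ).comp (continuous_const_smul _)

theorem freqResponse_conj (ψ : Space d → ℂ) (ω : Space d) :
    freqResponse (fun v => (starRingEnd ℂ) (ψ v)) ω = (starRingEnd ℂ) (freqResponse ψ (-ω)) := by
  rw [freqResponse, freqResponse, ← integral_conj]
  refine integral_congr_ae (Filter.Eventually.of_forall fun v => ?_)
  simp only [map_mul, ← Complex.exp_conj, inner_neg_left]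
  congr 2
  simp

theorem convAlong_conj {V G : Type*} [MeasurableSpace V] [AddCommGroup G] {vol : Measure V}
    {π : V → G} (x : G → ℝ) (ψ : V → ℂ) (t : G) :
    convAlong vol π (fun s => (x s : ℂ)) (fun v => (starRingEnd ℂ) (ψ v)) t =
      (starRingEnd ℂ) (convAlong vol π (fun s => (x s : ℂ)) ψ t) := by
  rw [convAlong, convAlong, ← integral_conj]
  simp

theorem integrable_conj {ψ : Space d → ℂ} (hψ : Integrable ψ) :
    Integrable fun v => (starRingEnd ℂ) (ψ v) :=
  ⟨hψ.1.star, by simpa [HasFiniteIntegral] using! hψ.2⟩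

/-- The sum `(1/2) ∑_l (|ψ̂_l(ω)|² + |ψ̂_l(-ω)|²)`. -/
noncomputable def filterEnergy {Λ : Type*} (ψ : Λ → Space d → ℂ) (ω : Space d) : ℝ≥0∞ :=
  2⁻¹ * ∑' l, (‖freqResponse (ψ l) ω‖ₑ ^ 2 + ‖freqResponse (ψ l) (-ω)‖ₑ ^ 2)

/-- Conjugating χ turns |χ̂(ω)| into |χ̂(-ω)|, so an energy blind to conjugation equals the average
of its expressions at ω and -ω. The measure ρ is Lebesgue measure for signals on ℝ^d and counting
measure on ℤ^d for periodic ones. -/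
theorem tsum_energy_eq {Λ Ω : Type*} [Countable Λ] [MeasurableSpace Ω] {ρ : Measure Ω}
    {w : Ω → ℝ≥0∞} (hw : AEMeasurable w ρ) {c : Ω → Space d} (hc : Measurable c)
    {E : (Space d → ℂ) → ℝ≥0∞} {ψ : Λ → Space d → ℂ} (hψ : ∀ l, Integrable (ψ l))
    (hE : ∀ χ, Integrable χ → E χ = ∫⁻ ξ, w ξ * ‖freqResponse χ (c ξ)‖ₑ ^ 2 ∂ρ)
    (hconj : ∀ χ, E (fun v => (starRingEnd ℂ) (χ v)) = E χ) :
    ∑' l, E (ψ l) = ∫⁻ ξ, w ξ * filterEnergy ψ (c ξ) ∂ρ := by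
  have hm : ∀ l, Measurable fun ξ => ‖freqResponse (ψ l) (c ξ)‖ₑ ^ 2 := fun l =>
    ((continuous_freqResponse (hψ l)).measurable.comp hc).enorm.pow_const 2
  have hm' : ∀ l, Measurable fun ξ => ‖freqResponse (ψ l) (-c ξ)‖ₑ ^ 2 := fun l =>
    ((continuous_freqResponse (hψ l)).measurable.comp hc.neg).enorm.pow_const 2
  have hs : ∀ l, AEMeasurable (fun ξ => w ξ * (‖freqResponse (ψ l) (c ξ)‖ₑ ^ 2 +
      ‖freqResponse (ψ l) (-c ξ)‖ₑ ^ 2)) ρ := fun l => hw.mul ((hm l).add (hm' l)).aemeasurable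
  have h1 : ∀ l, E (ψ l) = ∫⁻ ξ, 2⁻¹ * (w ξ * (‖freqResponse (ψ l) (c ξ)‖ₑ ^ 2 +
      ‖freqResponse (ψ l) (-c ξ)‖ₑ ^ 2)) ∂ρ := by
    intro l
    have h2 : E (ψ l) = ∫⁻ ξ, w ξ * ‖freqResponse (ψ l) (-c ξ)‖ₑ ^ 2 ∂ρ := by
      rw [← hconj, hE _ (integrable_conj (hψ l))]
      refine lintegral_congr fun ξ => ?_
      rw [freqResponse_conj]
      congr 2
      exact enorm_eq_iff_norm_eq.2 (by simp)
    rw [lintegral_const_mul'' _ (hs l)]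
    simp only [mul_add]
    have hs1 : AEMeasurable (fun ξ => w ξ * ‖freqResponse (ψ l) (c ξ)‖ₑ ^ 2) ρ :=
      hw.mul (hm l).aemeasurable
    rw [lintegral_add_left' hs1, ← h2, ← hE _ (hψ l), ← two_mul,
      ← mul_assoc, ENNReal.inv_mul_cancel two_ne_zero ENNReal.ofNat_ne_top, one_mul]
  simp_rw [h1]
  rw [← lintegral_tsum fun l => (hs l).const_mul _]
  refine lintegral_congr fun ξ => ?_
  rw [ENNReal.tsum_mul_left, ENNReal.tsum_mul_left, filterEnergy]
  ring

theorem filtered_eq_convAlong (x : Space d → ℝ) (ψ : Space d → ℂ) :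
    filtered x ψ = convAlong volume id (fun v => (x v : ℂ)) ψ := by
  ext u
  rw [filtered, convolution_eq_swap, convAlong]
  simp

theorem filtered_congr {x y : Space d → ℝ} (h : x =ᵐ[volume] y) (ψ : Space d → ℂ) :
    filtered x ψ = filtered y ψ :=
  convolution_congr _ h (Filter.EventuallyEq.refl _ _)

theorem measurable_filtered {x : Space d → ℝ} (hx : Measurable x) {ψ : Space d → ℂ}
    (hψ : Integrable ψ) : Measurable (filtered x ψ) := by
  rw [filtered_eq_convAlong]
  exact measurable_convAlong measurable_id (Complex.measurable_ofReal.comp hx) hψ.1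

theorem memLp_two_ofReal {α : Type*} [MeasurableSpace α] {μ : Measure α} {x : α → ℝ}
    (hx : MemLp x 2 μ) : MemLp (fun a => (x a : ℂ)) 2 μ := hx.ofReal

theorem filtered_sub {x y : Space d → ℝ} (hx : Measurable x) (hx2 : MemLp x 2 volume)
    (hy : Measurable y) (hy2 : MemLp y 2 volume) {ψ : Space d → ℂ} (hψ : Integrable ψ) :
    filtered (x - y) ψ =ᵐ[volume] filtered x ψ - filtered y ψ := by
  have h := convAlong_sub_left measurable_id (Complex.measurable_ofReal.comp hx)
    (memLp_two_ofReal hx2) (Complex.measurable_ofReal.comp hy) (memLp_two_ofReal hy2) hψ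
  rw [filtered_eq_convAlong, filtered_eq_convAlong, filtered_eq_convAlong]
  refine Filter.EventuallyEq.trans (Filter.EventuallyEq.of_eq ?_) h
  congr 1
  ext v
  simp

variable {Λ : Type*} {ψ : Λ → Space d → ℂ} {η : ℝ}

theorem tsum_lintegral_filtered_eq [Countable Λ] (hψ : ∀ l, Integrable (ψ l))
    (x : Lp ℝ 2 (volume : Measure (Space d))) :
    ∃ w : Space d → ℝ≥0∞, AEMeasurable w ∧ ∫⁻ ξ, w ξ = ‖x‖ₑ ^ 2 ∧
      ∑' l, ∫⁻ u, ‖filtered x (ψ l) u‖ₑ ^ 2 =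
        ∫⁻ ξ, w ξ * filterEnergy ψ ((2 * Real.pi) • ξ) := by
  have hx := memLp_two_ofReal (Lp.memLp x)
  set f := hx.toLp _ with hf
  have hfx : f =ᵐ[volume] fun v => (x v : ℂ) := hx.coeFn_toLp
  refine ⟨fun ξ => ‖(𝓕 f : Lp ℂ 2 (volume : Measure (Space d))) ξ‖ₑ ^ 2,
    (Lp.aestronglyMeasurable _).enorm.pow_const 2, ?_, ?_⟩
  · rw [← enorm_Lp_two_sq, enorm_eq_iff_norm_eq.2 (Lp.norm_fourier_eq f), enorm_Lp_two_sq,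
      enorm_Lp_two_sq]
    refine lintegral_congr_ae ?_
    filter_upwards [hfx] with v hv
    rw [hv, enorm_eq_iff_norm_eq.2 (Complex.norm_real (x v))]
  · refine tsum_energy_eq (E := fun χ => ∫⁻ u, ‖filtered x χ u‖ₑ ^ 2)
      ((Lp.aestronglyMeasurable _).enorm.pow_const 2) (measurable_const_smul _) hψ ?_ ?_
    · intro χ hχ
      have h1 : filtered x χ = convAlong volume id f χ := by
        rw [filtered_eq_convAlong, convAlong_id_eq_convolution, convAlong_id_eq_convolution]
        exact convolution_congr _ hfx.symm (Filter.EventuallyEq.refl _ _)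
      rw [h1, ← eLpNorm_two_sq, eLpNorm_convAlong_eq f hχ, eLpNorm_two_sq]
      refine lintegral_congr fun ξ => ?_
      rw [enorm_mul, mul_pow, fourier_eq_freqResponse]
    · intro χ
      refine lintegral_congr fun u => ?_
      rw [filtered_eq_convAlong, filtered_eq_convAlong, convAlong_conj]
      congr 1
      exact enorm_eq_iff_norm_eq.2 (by simp)

/-- `𝓕` uses the kernel exp(-2πi ξ·u), hence the dilation ω = 2πξ; it preserves null sets. -/
theorem ae_filterEnergy_dilate (hLP : LittlewoodPaley ψ η) :
    ∀ᵐ ξ : Space d, ENNReal.ofReal ((1 - η) ^ 2) ≤ filterEnergy ψ ((2 * Real.pi) • ξ) ∧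
      filterEnergy ψ ((2 * Real.pi) • ξ) ≤ ENNReal.ofReal ((1 + η) ^ 2) :=
  (Measure.quasiMeasurePreserving_smul volume Real.two_pi_pos.ne').ae hLP

theorem le_tsum_lintegral_filtered [Countable Λ] (hψ : ∀ l, Integrable (ψ l)) (hLP : LittlewoodPaley ψ η)
    (x : Lp ℝ 2 (volume : Measure (Space d))) :
    ENNReal.ofReal ((1 - η) ^ 2) * ‖x‖ₑ ^ 2 ≤ ∑' l, ∫⁻ u, ‖filtered x (ψ l) u‖ₑ ^ 2 := by
  obtain ⟨w, hw, hwx, h⟩ := tsum_lintegral_filtered_eq hψ x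
  rw [h, ← hwx, mul_comm, ← lintegral_mul_const'' _ hw]
  refine lintegral_mono_ae ?_
  filter_upwards [ae_filterEnergy_dilate hLP] with ξ hξ
  gcongr
  exact hξ.1

theorem tsum_lintegral_filtered_le [Countable Λ] (hψ : ∀ l, Integrable (ψ l)) (hLP : LittlewoodPaley ψ η)
    (x : Lp ℝ 2 (volume : Measure (Space d))) :
    ∑' l, ∫⁻ u, ‖filtered x (ψ l) u‖ₑ ^ 2 ≤ ENNReal.ofReal ((1 + η) ^ 2) * ‖x‖ₑ ^ 2 := by
  obtain ⟨w, hw, hwx, h⟩ := tsum_lintegral_filtered_eq hψ x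
  rw [h, ← hwx, mul_comm (ENNReal.ofReal _), ← lintegral_mul_const'' _ hw]
  refine lintegral_mono_ae ?_
  filter_upwards [ae_filterEnergy_dilate hLP] with ξ hξ
  gcongr
  exact hξ.2

/-- The upper Littlewood–Paley bound holds at every frequency. -/
theorem filterEnergy_le (hψ : ∀ l, Integrable (ψ l)) (hLP : LittlewoodPaley ψ η) (ω : Space d) :
    filterEnergy ψ ω ≤ ENNReal.ofReal ((1 + η) ^ 2) := by
  -- Finite partial sums are continuous because the filters are integrable, so a bound valid almost
  -- everywhere holds everywhere for them, hence for their supremum. The torus needs this: it sees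
  -- only a lattice of frequencies, which is null for d ≥ 1.
  rw [filterEnergy, ← ENNReal.tsum_mul_left, ENNReal.tsum_eq_iSup_sum]
  refine iSup_le fun s => ?_
  have hc : Continuous fun ω => ∑ l ∈ s,
      2⁻¹ * (‖freqResponse (ψ l) ω‖ₑ ^ 2 + ‖freqResponse (ψ l) (-ω)‖ₑ ^ 2) := by
    refine continuous_finsetSum _ fun l _ => ?_
    have h1 := continuous_freqResponse (hψ l)
    refine ENNReal.continuous_const_mul (by simp) |>.comp ?_
    exact ((ENNReal.continuous_pow 2).comp h1.enorm).add
      ((ENNReal.continuous_pow 2).comp (h1.comp continuous_neg).enorm)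
  have hcl := isClosed_le hc (continuous_const (y := ENNReal.ofReal ((1 + η) ^ 2)))
  have hd : Dense {ω | ∑ l ∈ s,
      2⁻¹ * (‖freqResponse (ψ l) ω‖ₑ ^ 2 + ‖freqResponse (ψ l) (-ω)‖ₑ ^ 2) ≤
        ENNReal.ofReal ((1 + η) ^ 2)} := by
    refine Measure.dense_of_ae (μ := (volume : Measure (Space d))) ?_
    filter_upwards [hLP] with ω hω
    refine le_trans ?_ hω.2
    rw [← ENNReal.tsum_mul_left]
    exact ENNReal.sum_le_tsum s
  have := hcl.closure_eq ▸ hd.closure_eq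
  exact (Set.eq_univ_iff_forall.1 this) ω

end Energy

/-! ### Characters turn convolution into multiplication. -/

section Characters

variable {V G : Type*} [MeasurableSpace V] [MeasurableSpace G] [AddCommGroup G]
  {vol : Measure V} {μ : Measure G} {π : V → G} {X : G → ℂ} {ψ : V → ℂ}

theorem integrable_convAlong_integrand [SFinite vol] [SFinite μ] [MeasurableAdd G]
    [MeasurableSub₂ G] [μ.IsAddRightInvariant] (hπ : Measurable π) (hX : Measurable X)
    (hX1 : Integrable X μ) (hψ : Integrable ψ vol) :
    Integrable (fun z : G × V => X (z.1 - π z.2) * ψ z.2) (μ.prod vol) := by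
  have hm : AEStronglyMeasurable (fun z : G × V => X (z.1 - π z.2) * ψ z.2) (μ.prod vol) :=
    (hX.comp (measurable_fst.sub (hπ.comp measurable_snd))).aestronglyMeasurable.mul
      hψ.1.comp_snd
  refine ⟨hm, ?_⟩
  rw [HasFiniteIntegral, lintegral_prod_symm _ hm.enorm]
  have h1 : ∀ v, ∫⁻ t, ‖X (t - π v) * ψ v‖ₑ ∂μ = (∫⁻ t, ‖X t‖ₑ ∂μ) * ‖ψ v‖ₑ := by
    intro v
    simp only [enorm_mul]
    rw [lintegral_mul_const' _ _ enorm_ne_top, lintegral_sub_right_eq_self (fun t => ‖X t‖ₑ)]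
  simp only [h1]
  rw [lintegral_const_mul'' _ hψ.1.enorm]
  exact ENNReal.mul_lt_top hX1.2 hψ.2

/-- Fubini, the splitting χ(t) = χ(t - π v) χ(π v), and translation invariance. -/
theorem integral_character_mul_convAlong [SFinite vol] [SFinite μ] [MeasurableAdd G]
    [MeasurableSub₂ G] [μ.IsAddRightInvariant] (hπ : Measurable π) (hX : Measurable X)
    (hX1 : Integrable X μ) (hψ : Integrable ψ vol) {χ : G → ℂ} (hχ : Measurable χ)
    (hχ1 : ∀ t, ‖χ t‖ ≤ 1) (hadd : ∀ s t, χ (s + t) = χ s * χ t) :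
    ∫ t, χ t * convAlong vol π X ψ t ∂μ = (∫ t, χ t * X t ∂μ) * ∫ v, χ (π v) * ψ v ∂vol := by
  have hint : Integrable (fun z : G × V => χ z.1 * (X (z.1 - π z.2) * ψ z.2)) (μ.prod vol) :=
    (integrable_convAlong_integrand hπ hX hX1 hψ).bdd_mul (c := 1)
      (hχ.comp measurable_fst).aestronglyMeasurable
      (Filter.Eventually.of_forall fun z => hχ1 z.1)
  simp only [convAlong, ← integral_const_mul]
  rw [integral_integral_swap hint]
  refine integral_congr_ae (Filter.Eventually.of_forall fun v => ?_)
  have h1 : ∀ t, χ t * (X (t - π v) * ψ v) =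
      (χ (t - π v) * X (t - π v)) * (χ (π v) * ψ v) := by
    intro t
    have := hadd (t - π v) (π v)
    rw [sub_add_cancel] at this
    rw [this]
    ring
  simp only [h1]
  rw [integral_mul_const, integral_sub_right_eq_self (fun t => χ t * X t)]

end Characters

/-! ### Periodic signals as functions on the unit torus. -/

section Torus

noncomputable local instance measureSpaceUnitCircle : MeasureSpace UnitAddCircle := ⟨AddCircle.haarAddCircle⟩

local instance : Measure.IsAddHaarMeasure (volume : Measure UnitAddCircle) :=
  inferInstanceAs (Measure.IsAddHaarMeasure AddCircle.haarAddCircle)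

local instance : IsProbabilityMeasure (volume : Measure UnitAddCircle) :=
  inferInstanceAs (IsProbabilityMeasure AddCircle.haarAddCircle)

open UnitAddTorus

variable {d : ℕ}

/-- The reduction of `ℝ^d` modulo `L` in each coordinate, onto the unit torus. -/
noncomputable def toTorus (L : ℝ) (v : Space d) : UnitAddTorus (Fin d) := fun i => ((v i / L : ℝ) : UnitAddCircle)

theorem measurable_toTorus (L : ℝ) : Measurable (toTorus L : Space d → _) := by
  refine measurable_pi_iff.2 fun i => AddCircle.measurable_mk'.comp ?_
  fun_prop

theorem toTorus_sub (L : ℝ) (u v : Space d) : toTorus L (u - v) = toTorus L u - toTorus L v := by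
  ext i
  simp [toTorus, sub_div]

/-- The function on the unit torus given by a function on the cube of side `L`. -/
noncomputable def torusFun (L : ℝ) (x : Space d → ℝ) (t : UnitAddTorus (Fin d)) : ℝ :=
  x (WithLp.toLp 2 fun i => ((AddCircle.equivIco 1 0 (t i)) : ℝ) * L)

theorem measurable_torusFun (L : ℝ) {x : Space d → ℝ} (hx : Measurable x) :
    Measurable (torusFun L x) := by
  refine hx.comp ?_
  refine (PiLp.volume_preserving_toLp (Fin d)).measurable.comp ?_
  refine measurable_pi_iff.2 fun i => Measurable.mul_const ?_ L
  exact measurable_subtype_coe.comp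
    ((AddCircle.measurableEquivIco 1 0).measurable.comp (measurable_pi_apply i))

theorem torusFun_toTorus {L : ℝ} (hL : 0 < L) (x : Space d → ℝ) (u : Space d) :
    torusFun L x (toTorus L u) = periodicExt hL x u := by
  rw [torusFun, periodicExt, reduceMod]
  congr 2
  ext i
  rw [toTorus, AddCircle.coe_equivIco_mk_apply, toIcoMod_eq_fract_mul]
  simp

theorem filtered_periodicExt {L : ℝ} (hL : 0 < L) (x : Space d → ℝ) (ψ : Space d → ℂ)
    (u : Space d) : filtered (periodicExt hL x) ψ u =
      convAlong volume (toTorus L) (fun t => (torusFun L x t : ℂ)) ψ (toTorus L u) := by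
  rw [filtered_eq_convAlong, convAlong, convAlong]
  simp only [← torusFun_toTorus, ← toTorus_sub, id]

theorem measurable_periodicExt {L : ℝ} (hL : 0 < L) {x : Space d → ℝ} (hx : Measurable x) :
    Measurable (periodicExt hL x) := by
  have h : periodicExt hL x = torusFun L x ∘ toTorus L :=
    funext fun u => (torusFun_toTorus hL x u).symm
  rw [h]
  exact (measurable_torusFun L hx).comp (measurable_toTorus L)

theorem measurableSet_cube (d : ℕ) (L : ℝ) : MeasurableSet (cube d L) := by
  have : cube d L = ⋂ i, (fun u : Space d => u i) ⁻¹' Set.Icc 0 L := by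
    ext u
    simp [cube]
  rw [this]
  exact MeasurableSet.iInter fun i => measurableSet_Icc.preimage (by fun_prop)

theorem periodicExt_ae_eq {L : ℝ} (hL : 0 < L) (x : Space d → ℝ) :
    periodicExt hL x =ᵐ[volume.restrict (cube d L)] x := by
  have h1 : ∀ i, ∀ᵐ u : Space d, u i ≠ L := fun i =>
    (PiLp.volume_preserving_ofLp (Fin d)).quasiMeasurePreserving.ae (Measure.ae_eval_ne (fun _ : Fin d => (volume : Measure ℝ)) i L)
  filter_upwards [ae_restrict_of_ae (ae_all_iff.2 h1),
    ae_restrict_mem (measurableSet_cube d L)] with u hu huc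
  rw [periodicExt, reduceMod]
  congr 1
  ext i
  exact (toIcoMod_eq_self hL).2 ⟨(huc i).1, by simpa using lt_of_le_of_ne (huc i).2 (hu i)⟩

/-- Dilation by L, then removal of null faces; the half-open unit box is the fundamental domain in
`UnitAddTorus.lintegral_preimage`. -/
theorem lintegral_cube_eq {L : ℝ} (hL : 0 < L) {f : Space d → ℝ≥0∞} (hf : Measurable f) :
    ∫⁻ u in cube d L, f u = ENNReal.ofReal (L ^ d) *
      ∫⁻ y : Fin d → ℝ in {y | ∀ i, y i ∈ Set.Ioc (0 : ℝ) (0 + 1)},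
        f (WithLp.toLp 2 fun i => L * y i) := by
  have hms := measurableSet_cube d L
  have hg : Measurable ((cube d L).indicator f) := hf.indicator hms
  have h1 : ∫⁻ y : Fin d → ℝ, (cube d L).indicator f (WithLp.toLp 2 (L • y)) =
      ENNReal.ofReal (L ^ d)⁻¹ * ∫⁻ u in cube d L, f u := by
    rw [← lintegral_indicator hms,
      ← (PiLp.volume_preserving_toLp (Fin d)).lintegral_comp hg]
    have h2 := Measure.map_addHaar_smul (volume : Measure (Fin d → ℝ)) hL.ne'
    rw [Module.finrank_fin_fun, abs_of_pos (by positivity)] at h2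
    have hg' : Measurable fun y : Fin d → ℝ => (cube d L).indicator f (WithLp.toLp 2 y) :=
      hg.comp (PiLp.volume_preserving_toLp (Fin d)).measurable
    rw [← smul_eq_mul, ← lintegral_smul_measure, ← h2, lintegral_map hg'
      (measurable_const_smul L)]
  have h3 : ∫⁻ y : Fin d → ℝ, (cube d L).indicator f (WithLp.toLp 2 (L • y)) =
      ∫⁻ y : Fin d → ℝ in {y | ∀ i, y i ∈ Set.Ioc (0 : ℝ) (0 + 1)},
        f (WithLp.toLp 2 fun i => L * y i) := by
    have h4 : {y : Fin d → ℝ | ∀ i, y i ∈ Set.Ioc (0 : ℝ) (0 + 1)} =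
        Set.pi Set.univ fun _ => Set.Ioc (0 : ℝ) 1 := by
      ext y
      simp
    rw [h4, volume_pi, setLIntegral_congr Measure.univ_pi_Ioc_ae_eq_Icc,
      ← lintegral_indicator measurableSet_Icc]
    refine lintegral_congr fun y => ?_
    have h5 : WithLp.toLp 2 (L • y) ∈ cube d L ↔ y ∈ Set.Icc (fun _ => (0 : ℝ)) fun _ => 1 := by
      simp only [cube, Set.mem_ofPred_eq, Set.mem_Icc, Pi.smul_apply, smul_eq_mul, Pi.le_def,
        ← forall_and]
      refine forall_congr' fun i => and_congr ?_ ?_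
      · exact mul_nonneg_iff_of_pos_left hL
      · exact mul_le_iff_le_one_right hL
    by_cases hy : y ∈ Set.Icc (fun _ => (0 : ℝ)) fun _ => 1
    · rw [Set.indicator_of_mem (h5.2 hy), Set.indicator_of_mem hy]
      rfl
    · rw [Set.indicator_of_notMem (fun h => hy (h5.1 h)), Set.indicator_of_notMem hy]
  rw [← h3, h1, ← mul_assoc, ← ENNReal.ofReal_mul (by positivity), mul_inv_cancel₀ (by positivity),
    ENNReal.ofReal_one, one_mul]

theorem lintegral_cube_toTorus {L : ℝ} (hL : 0 < L) {f : UnitAddTorus (Fin d) → ℝ≥0∞}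
    (hf : Measurable f) :
    ∫⁻ u in cube d L, f (toTorus L u) = ENNReal.ofReal (L ^ d) * ∫⁻ t, f t := by
  have h := lintegral_cube_eq hL (hf.comp (measurable_toTorus L))
  simp only [Function.comp_apply] at h
  rw [h, UnitAddTorus.lintegral_preimage f 0]
  congr 2
  ext y
  congr 1
  ext i
  simp [toTorus, hL.ne']

theorem volume_cube {L : ℝ} (hL : 0 < L) : volume (cube d L) = ENNReal.ofReal (L ^ d) := by
  have h := lintegral_cube_toTorus (d := d) hL (f := fun _ => 1) measurable_const
  simpa using h

theorem tsum_enorm_mFourierCoeff_sq {f : UnitAddTorus (Fin d) → ℂ} (hf : MemLp f 2 volume) :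
    ∑' n, ‖mFourierCoeff f n‖ₑ ^ 2 = ∫⁻ t, ‖f t‖ₑ ^ 2 := by
  have h := hasSum_sq_mFourierCoeff (hf.toLp f)
  have hc : mFourierCoeff (hf.toLp f) = mFourierCoeff f := by
    ext n
    refine integral_congr_ae ?_
    filter_upwards [hf.coeFn_toLp] with t ht
    rw [ht]
  have hi : ∫ t, ‖hf.toLp f t‖ ^ 2 = ∫ t, ‖f t‖ ^ 2 := by
    refine integral_congr_ae ?_
    filter_upwards [hf.coeFn_toLp] with t ht
    rw [ht]
  rw [hc, hi] at h
  have h1 : ∀ z : ℂ, ‖z‖ₑ ^ 2 = ENNReal.ofReal (‖z‖ ^ 2) := fun z => by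
    rw [← ofReal_norm, ENNReal.ofReal_pow (norm_nonneg _)]
  simp only [h1]
  rw [← ENNReal.ofReal_tsum_of_nonneg (fun _ => by positivity) h.summable, h.tsum_eq,
    ofReal_integral_eq_lintegral_ofReal]
  · exact (memLp_two_iff_integrable_sq_norm hf.1).1 hf
  · exact Filter.Eventually.of_forall fun _ => by positivity

/-- The frequency of the character `n` of the torus of side `L`. -/
noncomputable def torusFreq (L : ℝ) (n : Fin d → ℤ) : Space d :=
  WithLp.toLp 2 fun i => 2 * Real.pi * n i / L

theorem mFourier_neg_toTorus (L : ℝ) (n : Fin d → ℤ) (v : Space d) :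
    mFourier (-n) (toTorus L v) =
      Complex.exp (-(Complex.I * ((inner ℝ (torusFreq L n) v : ℝ) : ℂ))) := by
  simp only [mFourier, ContinuousMap.coe_mk, toTorus, fourier_coe_apply, ← Complex.exp_sum,
    PiLp.inner_apply, torusFreq]
  congr 1
  push_cast
  rw [Finset.mul_sum, ← Finset.sum_neg_distrib]
  refine Finset.sum_congr rfl fun i _ => ?_
  simp
  ring

/-- The filter lives on ℝ^d, so the multiplier is its Fourier transform on ℝ^d sampled at 2πn/L. -/
theorem mFourierCoeff_convAlong (L : ℝ) {X : UnitAddTorus (Fin d) → ℂ} (hX : Measurable X)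
    (hX1 : Integrable X) {ψ : Space d → ℂ} (hψ : Integrable ψ) (n : Fin d → ℤ) :
    mFourierCoeff (convAlong volume (toTorus L) X ψ) n =
      mFourierCoeff X n * freqResponse ψ (torusFreq L n) := by
  simp only [mFourierCoeff, smul_eq_mul]
  rw [integral_character_mul_convAlong (measurable_toTorus L) hX hX1 hψ
    (mFourier (-n)).continuous.measurable]
  · simp only [mFourier_neg_toTorus, freqResponse]
  · intro t
    exact ((mFourier (-n)).norm_coe_le_norm t).trans_eq mFourier_norm
  · intro s t
    simp only [mFourier, ContinuousMap.coe_mk, Pi.add_apply, ← Finset.prod_mul_distrib]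
    refine Finset.prod_congr rfl fun i _ => ?_
    simp [fourier_apply, AddCircle.toCircle_add, smul_add]

variable {Λ : Type*} [Countable Λ] {ψ : Λ → Space d → ℂ} {η : ℝ}

theorem tsum_lintegral_torus_le (hψ : ∀ l, Integrable (ψ l)) (hLP : LittlewoodPaley ψ η) (L : ℝ)
    {X : UnitAddTorus (Fin d) → ℝ} (hX : Measurable X) (hX2 : MemLp X 2) :
    ∑' l, ∫⁻ t, ‖convAlong volume (toTorus L) (fun t => (X t : ℂ)) (ψ l) t‖ₑ ^ 2 ≤
      ENNReal.ofReal ((1 + η) ^ 2) * ∫⁻ t, ‖X t‖ₑ ^ 2 := by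
  have hXm : Measurable fun t => (X t : ℂ) := Complex.measurable_ofReal.comp hX
  have hXC := memLp_two_ofReal hX2
  rw [tsum_energy_eq (E := fun χ => ∫⁻ t, ‖convAlong volume (toTorus L) (fun t => (X t : ℂ)) χ t‖ₑ ^ 2)
    (ρ := (Measure.count : Measure (Fin d → ℤ)))
    (w := fun n => ‖mFourierCoeff (fun t => (X t : ℂ)) n‖ₑ ^ 2) (c := torusFreq L)
    (Measurable.of_discrete).aemeasurable Measurable.of_discrete hψ]
  · have h1 : ∫⁻ t, ‖X t‖ₑ ^ 2 = ∑' n, ‖mFourierCoeff (fun t => (X t : ℂ)) n‖ₑ ^ 2 := by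
      rw [tsum_enorm_mFourierCoeff_sq hXC]
      refine lintegral_congr fun t => ?_
      rw [enorm_eq_iff_norm_eq.2 (Complex.norm_real (X t))]
    rw [lintegral_count, h1, ← ENNReal.tsum_mul_left]
    refine ENNReal.tsum_le_tsum fun n => ?_
    rw [mul_comm]
    gcongr
    exact filterEnergy_le hψ hLP _
  · intro χ hχ
    rw [lintegral_count, ← tsum_enorm_mFourierCoeff_sq
      (memLp_convAlong (measurable_toTorus L) hXm hXC hχ)]
    refine tsum_congr fun n => ?_
    rw [mFourierCoeff_convAlong L hXm (hXC.integrable one_le_two) hχ, enorm_mul, mul_pow]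
  · intro χ
    refine lintegral_congr fun u => ?_
    rw [convAlong_conj]
    congr 1
    exact enorm_eq_iff_norm_eq.2 (by simp)

variable {L : ℝ} {x y : Space d → ℝ}

theorem lintegral_torusFun (hL : 0 < L) (hx : Measurable x) :
    ENNReal.ofReal (L ^ d) * ∫⁻ t, ‖torusFun L x t‖ₑ ^ 2 = ∫⁻ u in cube d L, ‖x u‖ₑ ^ 2 := by
  rw [← lintegral_cube_toTorus hL ((measurable_torusFun L hx).enorm.pow_const 2)]
  simp only [torusFun_toTorus hL]
  refine lintegral_congr_ae ?_
  filter_upwards [periodicExt_ae_eq hL x] with u hu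
  rw [hu]

theorem memLp_torusFun (hL : 0 < L) (hx : Measurable x)
    (hx2 : MemLp x 2 (volume.restrict (cube d L))) : MemLp (torusFun L x) 2 volume := by
  rw [memLp_two_iff_lintegral (measurable_torusFun L hx).aestronglyMeasurable]
  have h := lintegral_lt_top_of_memLp_two hx2
  rw [← lintegral_torusFun hL hx] at h
  refine lt_top_iff_ne_top.2 fun hc => ?_
  rw [hc, ENNReal.mul_top (by simpa using pow_pos hL d)] at h
  exact lt_irrefl _ h

theorem measurable_filtered_periodicExt (hL : 0 < L) (hx : Measurable x) {ψ : Space d → ℂ}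
    (hψ : Integrable ψ) : Measurable (filtered (periodicExt hL x) ψ) :=
  measurable_filtered (measurable_periodicExt hL hx) hψ

theorem tsum_lintegral_periodic_le (hψ : ∀ l, Integrable (ψ l)) (hLP : LittlewoodPaley ψ η)
    (hL : 0 < L) (hx : Measurable x) (hx2 : MemLp x 2 (volume.restrict (cube d L))) :
    ∑' l, ∫⁻ u in cube d L, ‖filtered (periodicExt hL x) (ψ l) u‖ₑ ^ 2 ≤
      ENNReal.ofReal ((1 + η) ^ 2) * ∫⁻ u in cube d L, ‖x u‖ₑ ^ 2 := by
  simp only [filtered_periodicExt]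
  have hm : ∀ l, Measurable fun t => ‖convAlong volume (toTorus L)
      (fun t => (torusFun L x t : ℂ)) (ψ l) t‖ₑ ^ 2 := fun l =>
    (measurable_convAlong (measurable_toTorus L)
      (Complex.measurable_ofReal.comp (measurable_torusFun L hx)) (hψ l).1).enorm.pow_const 2
  simp_rw [fun l => lintegral_cube_toTorus hL (hm l)]
  rw [ENNReal.tsum_mul_left, ← lintegral_torusFun hL hx, mul_left_comm]
  gcongr
  exact tsum_lintegral_torus_le hψ hLP L (measurable_torusFun L hx) (memLp_torusFun hL hx hx2)

theorem filtered_periodicExt_sub (hL : 0 < L) (hx : Measurable x)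
    (hx2 : MemLp x 2 (volume.restrict (cube d L))) (hy : Measurable y)
    (hy2 : MemLp y 2 (volume.restrict (cube d L))) {ψ : Space d → ℂ} (hψ : Integrable ψ) :
    filtered (periodicExt hL (x - y)) ψ =ᵐ[volume.restrict (cube d L)]
      filtered (periodicExt hL x) ψ - filtered (periodicExt hL y) ψ := by
  have hxm := measurable_torusFun L hx
  have hym := measurable_torusFun L hy
  have h := convAlong_sub_left (measurable_toTorus L) (Complex.measurable_ofReal.comp hxm)
    (memLp_two_ofReal (memLp_torusFun hL hx hx2)) (Complex.measurable_ofReal.comp hym)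
    (memLp_two_ofReal (memLp_torusFun hL hy hy2)) hψ
  -- Additivity is known almost everywhere on the torus; a vanishing integral carries it to the
  -- cube.
  have h0 : ∫⁻ u in cube d L, ‖filtered (periodicExt hL (x - y)) ψ u -
      (filtered (periodicExt hL x) ψ - filtered (periodicExt hL y) ψ) u‖ₑ = 0 := by
    have e1 : (fun t => (torusFun L (x - y) t : ℂ)) =
        (fun t => (torusFun L x t : ℂ)) - fun t => (torusFun L y t : ℂ) := by
      ext t
      simp [torusFun]
    have m1 : Measurable fun t => (torusFun L x t : ℂ) := Complex.measurable_ofReal.comp hxm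
    have m2 : Measurable fun t => (torusFun L y t : ℂ) := Complex.measurable_ofReal.comp hym
    simp only [Pi.sub_apply, filtered_periodicExt, e1]
    rw [lintegral_cube_toTorus hL (f := fun t => ‖convAlong volume (toTorus L)
      ((fun t => (torusFun L x t : ℂ)) - fun t => (torusFun L y t : ℂ)) ψ t -
      (convAlong volume (toTorus L) (fun t => (torusFun L x t : ℂ)) ψ t -
        convAlong volume (toTorus L) (fun t => (torusFun L y t : ℂ)) ψ t)‖ₑ)
      ((measurable_convAlong (measurable_toTorus L) (m1.sub m2) hψ.1).sub
        ((measurable_convAlong (measurable_toTorus L) m1 hψ.1).sub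
          (measurable_convAlong (measurable_toTorus L) m2 hψ.1))).enorm]
    rw [lintegral_congr_ae (g := fun _ => 0)]
    · simp
    · filter_upwards [h] with t ht
      simp only [enorm_eq_zero, sub_eq_zero]
      exact ht
  have m0 := ((measurable_filtered_periodicExt hL (hx.sub hy) hψ).sub
    ((measurable_filtered_periodicExt hL hx hψ).sub
      (measurable_filtered_periodicExt hL hy hψ))).enorm
  filter_upwards [(lintegral_eq_zero_iff m0).1 h0] with u hu
  exact sub_eq_zero.1 (enorm_eq_zero.1 hu)

end Torus

/-! ### Estimates for Ux, Mx and Cx. -/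

section Representation

theorem phaseFamily_zero {α Λ : Type*} (h : Phase → ℂ) : phaseFamily h (fun (_ : Λ) (_ : α) => 0) = 0 := by
  ext z
  simp [phaseFamily, phaseFilter]

variable {d : ℕ} {Λ : Type*} [Countable Λ] [MeasurableSpace Λ] [MeasurableSingletonClass Λ]
  {ψ : Λ → Space d → ℂ} {η : ℝ} {h : Phase → ℂ}

theorem kappa_nonneg (h : Phase → ℂ) : 0 ≤ kappa h := Real.sqrt_nonneg _

theorem normSqFilter_nonneg (h : Phase → ℂ) : 0 ≤ normSqFilter h :=
  integral_nonneg fun _ => by positivity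

theorem memLp_phaseFamily {α : Type*} [MeasurableSpace α] {μ : Measure α}
    {F : Λ → α → ℂ} (hh : MemLp h 2 AddCircle.haarAddCircle) (hF : ∀ l, Measurable (F l))
    (hF2 : ∑' l, ∫⁻ u, ‖F l u‖ₑ ^ 2 ∂μ < ⊤) :
    MemLp (phaseFamily h F) 2 (μ.prod (phaseMeasure Λ)) := by
  rw [memLp_two_iff_lintegral (aestronglyMeasurable_phaseFamily hh.1 hF),
    lintegral_phaseFamily_sq hh hF]
  exact ENNReal.mul_lt_top ENNReal.ofReal_lt_top hF2

theorem memLp_phaseRep (hψ : ∀ l, Integrable (ψ l)) (hLP : LittlewoodPaley ψ η)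
    (hh : MemLp h 2 AddCircle.haarAddCircle) (x : Lp ℝ 2 (volume : Measure (Space d))) :
    MemLp (fun z : Space d × (Λ × Phase) => phaseRep ψ h x z.1 z.2) 2
      (volume.prod (phaseMeasure Λ)) :=
  memLp_phaseFamily (F := fun l => filtered x (ψ l)) hh (fun l => measurable_filtered (Lp.stronglyMeasurable x).measurable (hψ l))
    ((tsum_lintegral_filtered_le hψ hLP x).trans_lt
      (ENNReal.mul_lt_top ENNReal.ofReal_lt_top (ENNReal.pow_lt_top enorm_lt_top)))

theorem memLp_phaseRep_periodic (hψ : ∀ l, Integrable (ψ l)) (hLP : LittlewoodPaley ψ η)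
    (hh : MemLp h 2 AddCircle.haarAddCircle) {L : ℝ} (hL : 0 < L)
    (x : Lp ℝ 2 (volume.restrict (cube d L))) :
    MemLp (fun z : Space d × (Λ × Phase) => phaseRep ψ h (periodicExt hL x) z.1 z.2) 2
      ((volume.restrict (cube d L)).prod (phaseMeasure Λ)) := by
  have hx := (Lp.stronglyMeasurable x).measurable
  exact memLp_phaseFamily (F := fun l => filtered (periodicExt hL x) (ψ l)) hh (fun l => measurable_filtered_periodicExt hL hx (hψ l))
    ((tsum_lintegral_periodic_le hψ hLP hL hx (Lp.memLp x)).trans_lt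
      (ENNReal.mul_lt_top ENNReal.ofReal_lt_top (lintegral_lt_top_of_memLp_two (Lp.memLp x))))

theorem lintegral_phaseRep_periodic_sub_le (hψ : ∀ l, Integrable (ψ l))
    (hLP : LittlewoodPaley ψ η) (hh : MemLp h 2 AddCircle.haarAddCircle)
    (hs : Summable fun k : ℤ => (k : ℝ) ^ 2 * ‖fourierCoeff h k‖ ^ 2) {L : ℝ} (hL : 0 < L)
    (x x' : Lp ℝ 2 (volume.restrict (cube d L))) :
    ∫⁻ z, ‖phaseRep ψ h (periodicExt hL x) z.1 z.2 - phaseRep ψ h (periodicExt hL x') z.1 z.2‖ₑ ^ 2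
        ∂((volume.restrict (cube d L)).prod (phaseMeasure Λ)) ≤
      ENNReal.ofReal (kappa h ^ 2) * (ENNReal.ofReal ((1 + η) ^ 2) * ‖x - x'‖ₑ ^ 2) := by
  have hx := (Lp.stronglyMeasurable x).measurable
  have hx' := (Lp.stronglyMeasurable x').measurable
  refine (lintegral_phaseFamily_sub_sq_le hh hs
    (fun l => measurable_filtered_periodicExt hL hx (hψ l))
    (fun l => measurable_filtered_periodicExt hL hx' (hψ l))).trans ?_
  gcongr
  have h1 : ‖x - x'‖ₑ ^ 2 = ∫⁻ u in cube d L, ‖((x : Space d → ℝ) - (x' : Space d → ℝ)) u‖ₑ ^ 2 := by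
    rw [enorm_Lp_two_sq]
    refine lintegral_congr_ae ?_
    filter_upwards [Lp.coeFn_sub x x'] with u hu
    rw [hu]
  rw [h1]
  refine le_trans (le_of_eq ?_) (tsum_lintegral_periodic_le hψ hLP hL (hx.sub hx')
    ((Lp.memLp x).sub (Lp.memLp x')))
  refine tsum_congr fun l => lintegral_congr_ae ?_
  filter_upwards [filtered_periodicExt_sub hL hx (Lp.memLp x) hx' (Lp.memLp x') (hψ l)] with u hu
  rw [hu, Pi.sub_apply]

theorem lintegral_phaseRep_sub_le (hψ : ∀ l, Integrable (ψ l))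
    (hLP : LittlewoodPaley ψ η) (hh : MemLp h 2 AddCircle.haarAddCircle)
    (hs : Summable fun k : ℤ => (k : ℝ) ^ 2 * ‖fourierCoeff h k‖ ^ 2)
    (x x' : Lp ℝ 2 (volume : Measure (Space d))) :
    ∫⁻ z, ‖phaseRep ψ h x z.1 z.2 - phaseRep ψ h x' z.1 z.2‖ₑ ^ 2
        ∂((volume : Measure (Space d)).prod (phaseMeasure Λ)) ≤
      ENNReal.ofReal (kappa h ^ 2) * (ENNReal.ofReal ((1 + η) ^ 2) * ‖x - x'‖ₑ ^ 2) := by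
  have hx := (Lp.stronglyMeasurable x).measurable
  have hx' := (Lp.stronglyMeasurable x').measurable
  refine (lintegral_phaseFamily_sub_sq_le hh hs
    (fun l => measurable_filtered hx (hψ l)) (fun l => measurable_filtered hx' (hψ l))).trans ?_
  gcongr
  refine le_trans (le_of_eq ?_) (tsum_lintegral_filtered_le hψ hLP (x - x'))
  refine tsum_congr fun l => lintegral_congr_ae ?_
  filter_upwards [filtered_sub hx (Lp.memLp x) hx' (Lp.memLp x') (hψ l)] with u hu
  rw [filtered_congr (Lp.coeFn_sub x x'), hu, Pi.sub_apply]

/-- Comparison with the zero family, on which the phase filter vanishes, bounds ‖Ux‖ with κ in place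
of ‖h‖; this gives the factor κ² for Cx. -/
theorem lintegral_phaseRep_le (hψ : ∀ l, Integrable (ψ l))
    (hLP : LittlewoodPaley ψ η) (hh : MemLp h 2 AddCircle.haarAddCircle)
    (hs : Summable fun k : ℤ => (k : ℝ) ^ 2 * ‖fourierCoeff h k‖ ^ 2)
    (x : Lp ℝ 2 (volume : Measure (Space d))) :
    ∫⁻ z, ‖phaseRep ψ h x z.1 z.2‖ₑ ^ 2 ∂((volume : Measure (Space d)).prod (phaseMeasure Λ)) ≤
      ENNReal.ofReal (kappa h ^ 2) * (ENNReal.ofReal ((1 + η) ^ 2) * ‖x‖ₑ ^ 2) := by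
  have hx := (Lp.stronglyMeasurable x).measurable
  have h1 := lintegral_phaseFamily_sub_sq_le (μ := (volume : Measure (Space d))) hh hs
    (fun l => measurable_filtered hx (hψ l)) (F' := fun _ _ => 0) (fun _ => measurable_const)
  simp only [phaseFamily_zero, Pi.zero_apply, sub_zero] at h1
  refine h1.trans ?_
  gcongr
  exact tsum_lintegral_filtered_le hψ hLP x

theorem toReal_eLpNorm_le {α : Type*} [MeasurableSpace α] {μ : Measure α} {f : α → ℂ} {c : ℝ}
    (hc : 0 ≤ c) (hf : ∫⁻ a, ‖f a‖ₑ ^ 2 ∂μ ≤ ENNReal.ofReal (c ^ 2)) :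
    eLpNorm f 2 μ ≤ ENNReal.ofReal c := by
  rw [← ENNReal.pow_le_pow_left_iff two_ne_zero, eLpNorm_two_sq, ← ENNReal.ofReal_pow hc]
  exact hf

theorem ofReal_bound_eq {E : Type*} [NormedAddCommGroup E] (η : ℝ) (h : Phase → ℂ) (v : E) :
    ENNReal.ofReal (kappa h ^ 2) * (ENNReal.ofReal ((1 + η) ^ 2) * ‖v‖ₑ ^ 2) =
      ENNReal.ofReal ((kappa h * (1 + η) * ‖v‖) ^ 2) := by
  rw [← ofReal_norm, ← ENNReal.ofReal_pow (norm_nonneg _), ← ENNReal.ofReal_mul (by positivity),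
    ← ENNReal.ofReal_mul (by positivity)]
  congr 1
  ring

theorem isFiniteMeasure_cube {L : ℝ} (hL : 0 < L) :
    IsFiniteMeasure ((volume : Measure (Space d)).restrict (cube d L)) :=
  ⟨by rw [Measure.restrict_apply_univ, volume_cube hL]; exact ENNReal.ofReal_lt_top⟩

theorem ae_integrableOn_phaseRep (hψ : ∀ l, Integrable (ψ l)) (hLP : LittlewoodPaley ψ η)
    (hh : MemLp h 2 AddCircle.haarAddCircle) {L : ℝ} (hL : 0 < L)
    (x : Lp ℝ 2 (volume.restrict (cube d L))) :
    ∀ᵐ p ∂(phaseMeasure Λ),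
      IntegrableOn (fun u => phaseRep ψ h (periodicExt hL x) u p) (cube d L) volume := by
  have := isFiniteMeasure_cube (d := d) hL
  filter_upwards [memLp_two_ae_left
    (memLp_two_swap (memLp_phaseRep_periodic hψ hLP hh hL x))] with p hp
  exact hp.integrable one_le_two

theorem eLpNorm_meanVec_sub_le (hη : 0 ≤ η) (hψ : ∀ l, Integrable (ψ l))
    (hLP : LittlewoodPaley ψ η) (hh : MemLp h 2 AddCircle.haarAddCircle)
    (hs : Summable fun k : ℤ => (k : ℝ) ^ 2 * ‖fourierCoeff h k‖ ^ 2) {L : ℝ} (hL : 0 < L)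
    (x x' : Lp ℝ 2 (volume.restrict (cube d L))) :
    eLpNorm (meanVec ψ h hL x - meanVec ψ h hL x') 2 (phaseMeasure Λ) ≤
      ENNReal.ofReal (kappa h * (1 + η) * L ^ ((d : ℝ) / 2) * ‖x - x'‖) := by
  have := isFiniteMeasure_cube (d := d) hL
  have hk := kappa_nonneg h
  refine toReal_eLpNorm_le (by positivity) ?_
  have h1 := lintegral_mean_sq_le ((memLp_phaseRep_periodic hψ hLP hh hL x).sub
    (memLp_phaseRep_periodic hψ hLP hh hL x'))
  rw [Measure.restrict_apply_univ, volume_cube hL] at h1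
  have h2 : ∫⁻ p, ‖(meanVec ψ h hL x - meanVec ψ h hL x') p‖ₑ ^ 2 ∂(phaseMeasure Λ) =
      ∫⁻ p, ‖∫ u in cube d L, (phaseRep ψ h (periodicExt hL x) u p -
        phaseRep ψ h (periodicExt hL x') u p)‖ₑ ^ 2 ∂(phaseMeasure Λ) := by
    refine lintegral_congr_ae ?_
    filter_upwards [ae_integrableOn_phaseRep hψ hLP hh hL x,
      ae_integrableOn_phaseRep hψ hLP hh hL x'] with p hp hp'
    rw [integral_sub hp hp']
    rfl
  rw [h2]
  refine h1.trans ?_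
  refine (mul_le_mul_right (lintegral_phaseRep_periodic_sub_le hψ hLP hh hs hL x x') _).trans_eq ?_
  rw [ofReal_bound_eq, ← ENNReal.ofReal_mul (by positivity)]
  congr 1
  -- The factor L^(d/2) is the square root of the volume of the cube.
  have h3 : (L ^ ((d : ℝ) / 2)) ^ 2 = L ^ d := by
    rw [← Real.rpow_natCast, ← Real.rpow_mul hL.le, ← Real.rpow_natCast]
    congr 1
    push_cast
    ring
  rw [← h3]
  ring

/-- The kernel formula fixes T v almost everywhere for every v, so statements about any such T
reduce to the Gram operator. -/
theorem IsAutocorrOp.eq_gramOp (hψ : ∀ l, Integrable (ψ l)) (hLP : LittlewoodPaley ψ η)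
    (hh : MemLp h 2 AddCircle.haarAddCircle) {x : Lp ℝ 2 (volume : Measure (Space d))}
    {T : PhaseVec Λ →L[ℂ] PhaseVec Λ} (hT : IsAutocorrOp ψ h x T) :
    T = gramOp _ (memLp_phaseRep hψ hLP hh x) := by
  ext1 v
  apply Lp.ext
  filter_upwards [hT v, gramOp_apply (memLp_phaseRep hψ hLP hh x) v] with p h1 h2
  rw [h1, h2]
  rfl

theorem isAutocorrOp_gramOp (hψ : ∀ l, Integrable (ψ l)) (hLP : LittlewoodPaley ψ η)
    (hh : MemLp h 2 AddCircle.haarAddCircle) (x : Lp ℝ 2 (volume : Measure (Space d))) :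
    IsAutocorrOp ψ h x (gramOp _ (memLp_phaseRep hψ hLP hh x)) :=
  fun v => gramOp_apply (memLp_phaseRep hψ hLP hh x) v

theorem toReal_lintegral_phaseRep_bounds (hψ : ∀ l, Integrable (ψ l))
    (hLP : LittlewoodPaley ψ η) (hh : MemLp h 2 AddCircle.haarAddCircle)
    (x : Lp ℝ 2 (volume : Measure (Space d))) :
    (1 - η) ^ 2 * normSqFilter h * ‖x‖ ^ 2 ≤ (∫⁻ z, ‖phaseRep ψ h x z.1 z.2‖ₑ ^ 2
        ∂((volume : Measure (Space d)).prod (phaseMeasure Λ))).toReal ∧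
      (∫⁻ z, ‖phaseRep ψ h x z.1 z.2‖ₑ ^ 2
        ∂((volume : Measure (Space d)).prod (phaseMeasure Λ))).toReal ≤
        (1 + η) ^ 2 * normSqFilter h * ‖x‖ ^ 2 := by
  have hn := normSqFilter_nonneg h
  have hfin := lintegral_lt_top_of_memLp_two (memLp_phaseRep hψ hLP hh x)
  have h1 : ∫⁻ z, ‖phaseRep ψ h x z.1 z.2‖ₑ ^ 2
      ∂((volume : Measure (Space d)).prod (phaseMeasure Λ)) =
      ENNReal.ofReal (normSqFilter h) * ∑' l, ∫⁻ u, ‖filtered x (ψ l) u‖ₑ ^ 2 :=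
    lintegral_phaseFamily_sq (F := fun l => filtered x (ψ l)) hh
      fun l => measurable_filtered (Lp.stronglyMeasurable x).measurable (hψ l)
  have h2 : ∀ c : ℝ, 0 ≤ c → ENNReal.ofReal (c * normSqFilter h * ‖x‖ ^ 2) =
      ENNReal.ofReal (normSqFilter h) * (ENNReal.ofReal c * ‖x‖ₑ ^ 2) := by
    intro c hc
    rw [← ofReal_norm, ← ENNReal.ofReal_pow (norm_nonneg _), ← ENNReal.ofReal_mul hc,
      ← ENNReal.ofReal_mul hn]
    congr 1
    ring
  constructor
  · rw [← ENNReal.ofReal_le_iff_le_toReal hfin.ne, h1, h2 _ (by positivity)]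
    gcongr
    exact le_tsum_lintegral_filtered hψ hLP x
  · refine ENNReal.toReal_le_of_le_ofReal (by positivity) ?_
    rw [h1, h2 _ (by positivity)]
    gcongr
    exact tsum_lintegral_filtered_le hψ hLP x

theorem norm_gramOp_phaseRep_sub_le (hη : 0 ≤ η) (hψ : ∀ l, Integrable (ψ l))
    (hLP : LittlewoodPaley ψ η) (hh : MemLp h 2 AddCircle.haarAddCircle)
    (hs : Summable fun k : ℤ => (k : ℝ) ^ 2 * ‖fourierCoeff h k‖ ^ 2)
    (x x' : Lp ℝ 2 (volume : Measure (Space d))) :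
    ‖gramOp _ (memLp_phaseRep hψ hLP hh x) - gramOp _ (memLp_phaseRep hψ hLP hh x')‖ ≤
      kappa h ^ 2 * (1 + η) ^ 2 * ‖x - x'‖ * (‖x‖ + ‖x'‖) := by
  have hk := kappa_nonneg h
  refine (norm_gramOp_sub_le _ _).trans ?_
  have hU : ∀ y : Lp ℝ 2 (volume : Measure (Space d)),
      (eLpNorm (fun z : Space d × (Λ × Phase) => phaseRep ψ h y z.1 z.2) 2
        (volume.prod (phaseMeasure Λ))).toReal ≤ kappa h * (1 + η) * ‖y‖ := fun y =>
    ENNReal.toReal_le_of_le_ofReal (by positivity) (toReal_eLpNorm_le (by positivity)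
      ((lintegral_phaseRep_le hψ hLP hh hs y).trans_eq (ofReal_bound_eq η h y)))
  have hD := ENNReal.toReal_le_of_le_ofReal (by positivity)
    (toReal_eLpNorm_le (f := (fun z : Space d × (Λ × Phase) => phaseRep ψ h x z.1 z.2) -
        fun z : Space d × (Λ × Phase) => phaseRep ψ h x' z.1 z.2) (by positivity)
      ((lintegral_phaseRep_sub_le hψ hLP hh hs x x').trans_eq (ofReal_bound_eq η h (x - x'))))
  refine (mul_le_mul hD (add_le_add (hU x) (hU x')) (by positivity) (by positivity)).trans_eq ?_
  ring

end Representation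

end PhaseHarmonic

open PhaseHarmonic in
theorem mainTheorem3 {d : ℕ} {Λ : Type*} [Countable Λ] [MeasurableSpace Λ]
    [MeasurableSingletonClass Λ]
    (ψ : Λ → Space d → ℂ) (hψ : ∀ l, Integrable (ψ l) volume)
    (η : ℝ) (hη0 : 0 ≤ η) (hη1 : η < 1) (hLP : LittlewoodPaley ψ η)
    (h : Phase → ℂ) (hh : MemLp h 2 AddCircle.haarAddCircle) :
    -- the mean vector is a well-defined square integrable vector
    (∀ (L : ℝ) (hL : 0 < L) (x : Lp ℝ 2 (volume.restrict (cube d L))),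
      (∀ᵐ p ∂(phaseMeasure Λ),
        IntegrableOn (fun u => phaseRep ψ h (periodicExt hL x) u p) (cube d L) volume) ∧
      MemLp (meanVec ψ h hL x) 2 (phaseMeasure Λ)) ∧
    -- the mean vector is Lipschitz
    ((Summable fun k : ℤ => (k : ℝ) ^ 2 * ‖fourierCoeff h k‖ ^ 2) →
      ∀ (L : ℝ) (hL : 0 < L) (x x' : Lp ℝ 2 (volume.restrict (cube d L))),
        eLpNorm (meanVec ψ h hL x - meanVec ψ h hL x') 2 (phaseMeasure Λ) ≤
          ENNReal.ofReal (kappa h * (1 + η) * L ^ ((d : ℝ) / 2) * ‖x - x'‖)) ∧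
    -- the autocorrelation operator is a well-defined bounded operator
    (∀ x : Lp ℝ 2 (volume : Measure (Space d)),
      (∀ᵐ p ∂(phaseMeasure Λ), MemLp (fun u => phaseRep ψ h x u p) 2 volume) ∧
      ∃ T : PhaseVec Λ →L[ℂ] PhaseVec Λ, IsAutocorrOp ψ h x T) ∧
    -- bounds on its trace
    (∀ (x : Lp ℝ 2 (volume : Measure (Space d))) (T : PhaseVec Λ →L[ℂ] PhaseVec Λ),
      IsAutocorrOp ψ h x T →
        ∃ t : ℝ, HasTrace T t ∧
          (1 - η) ^ 2 * normSqFilter h * ‖x‖ ^ 2 ≤ t ∧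
          t ≤ (1 + η) ^ 2 * normSqFilter h * ‖x‖ ^ 2) ∧
    -- it is Lipschitz on bounded sets for the spectral norm
    ((Summable fun k : ℤ => (k : ℝ) ^ 2 * ‖fourierCoeff h k‖ ^ 2) →
      ∀ (x x' : Lp ℝ 2 (volume : Measure (Space d))) (T T' : PhaseVec Λ →L[ℂ] PhaseVec Λ),
        IsAutocorrOp ψ h x T → IsAutocorrOp ψ h x' T' →
          ‖T - T'‖ ≤ kappa h ^ 2 * (1 + η) ^ 2 * ‖x - x'‖ * (‖x‖ + ‖x'‖)) := by
  refine ⟨fun L hL x => ⟨ae_integrableOn_phaseRep hψ hLP hh hL x, ?_⟩,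
    fun hs L hL x x' => eLpNorm_meanVec_sub_le hη0 hψ hLP hh hs hL x x',
    fun x => ⟨memLp_two_ae_left (memLp_two_swap (memLp_phaseRep hψ hLP hh x)),
      _, isAutocorrOp_gramOp hψ hLP hh x⟩,
    fun x T hT => ?_, fun hs x x' T T' hT hT' => ?_⟩
  · have := isFiniteMeasure_cube (d := d) hL
    exact memLp_mean (memLp_phaseRep_periodic hψ hLP hh hL x)
  · rw [hT.eq_gramOp hψ hLP hh]
    exact ⟨_, hasTrace_gramOp (memLp_phaseRep hψ hLP hh x),
      toReal_lintegral_phaseRep_bounds hψ hLP hh x⟩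
  · rw [hT.eq_gramOp hψ hLP hh, hT'.eq_gramOp hψ hLP hh]
    exact norm_gramOp_phaseRep_sub_le hη0 hψ hLP hh hs x x'
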